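/- Let $(R,\mathfrak m)$ be a Gorenstein local ring (Noetherian) of dimension $1$, and let $I\neq(0)$ be an ideal of $R$ such that $R/I$ is a Cohen–Macaulay ring with $\dim R/I=1$. Put $J=(0):_R I=\{r\in R : rI=(0)\}$, and let $A=R\ltimes I$ be the idealization of $I$ over $R$, that is, $A=R\oplus I$ with multiplication $(a,x)(b,y)=(ab,\,bx+ay)$. Then $A$ is an almost Gorenstein local ring if and only if $I+J=\mathfrak m$. When this is the case, $I\cap J=(0)$. Here a Cohen–Macaulay local ring $(B,\mathfrak n)$ of dimension $d$ that possesses a canonical module $K_B$ is called an almost Gorenstein local ring if there is an exact sequence $0\to B\to K_B\to C\to 0$ of $B$-modules such that either $C=(0)$, or $C\neq(0)$ and $\mu_B(C)=e^0_{\mathfrak n}(C)$, where $\mu_B(C)$ is the minimal number of generators of $C$ and $$e^0_{\mathfrak n}(C)=\lim_{n\to\infty}(d-1)!\cdot\frac{\ell_B(C/\mathfrak n^{n+1}C)}{n^{d-1}}.$$ -/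

import Mathlib

universe u

open CategoryTheory Abelian Filter Topology

/-- The depth of a module `M` over a local ring `(R, 𝔪)`: the supremum of the lengths of the
`M`-regular sequences consisting of elements of `𝔪`. -/
noncomputable def localDepth (R : Type u) [CommRing R] [IsLocalRing R]
    (M : Type u) [AddCommGroup M] [Module R M] : ℕ∞ :=
  ⨆ (rs : List R) (_ : RingTheory.Sequence.IsRegular M rs ∧
      ∀ r ∈ rs, r ∈ IsLocalRing.maximalIdeal R), (rs.length : ℕ∞)

/-- A Cohen-Macaulay local ring: a Noetherian local ring `R` with `depth R = dim R`. -/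
class IsCohenMacaulayLocalRing (R : Type u) [CommRing R] : Prop
    extends IsLocalRing R, IsNoetherianRing R where
  depth_eq_dim : (localDepth R R : WithBot ℕ∞) = ringKrullDim R

/-- A Gorenstein local ring: a Noetherian local ring that has finite injective dimension as a
module over itself. -/
class IsGorensteinLocalRing (R : Type u) [CommRing R] : Prop
    extends IsLocalRing R, IsNoetherianRing R where
  finite_injectiveDimension : ∃ n : ℕ, HasInjectiveDimensionLE (ModuleCat.of R R) n

/-- A canonical module of a Cohen-Macaulay local ring `R` of dimension `d` with residue field `k`:
a maximal Cohen-Macaulay `R`-module (finitely generated, with `depth K = d`) of finite injective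
dimension and of type one (`Ext^d(k, K)` is one-dimensional over `k`). -/
structure IsCanonicalModule (R : Type u) [CommRing R] [IsCohenMacaulayLocalRing R]
    (K : Type u) [AddCommGroup K] [Module R K] : Prop where
  finite : Module.Finite R K
  depth_eq_dim : (localDepth R K : WithBot ℕ∞) = ringKrullDim R
  finite_injectiveDimension : ∃ n : ℕ, HasInjectiveDimensionLE (ModuleCat.of R K) n
  type_one : ∃ d : ℕ, ringKrullDim R = d ∧
    Nonempty (Ext (ModuleCat.of R (IsLocalRing.ResidueField R)) (ModuleCat.of R K) d
      ≃ₗ[R] IsLocalRing.ResidueField R)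

/-- `e` is the multiplicity of `C` with respect to the maximal ideal `𝔪`, normalized in
dimension `s`: `e = lim_{n → ∞} s! ⬝ ℓ(C / 𝔪 ^ (n + 1) C) / n ^ s`. For a finitely generated module
over a Noetherian local ring all these lengths are finite. -/
def HasMultiplicity (R : Type u) [CommRing R] [IsLocalRing R]
    (C : Type u) [AddCommGroup C] [Module R C] (s : ℕ) (e : ℝ) : Prop :=
  Tendsto (fun n : ℕ => (s.factorial : ℝ) *
      (((Module.length R
        (C ⧸ (IsLocalRing.maximalIdeal R ^ (n + 1) • (⊤ : Submodule R C)))).toNat : ℝ) /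
          (n : ℝ) ^ s))
    atTop (𝓝 e)

/-- An almost Gorenstein local ring: a Cohen-Macaulay local ring `R` possessing a canonical module
`K` and an exact sequence `0 → R → K → C → 0` of `R`-modules (so `C` is the cokernel of an injective
`R`-linear map `φ : R → K`) such that `C = 0`, or `C ≠ 0` and the minimal number of generators of
`C` equals the multiplicity of `C`, normalized in dimension `dim R - 1`.
For `dim R = 0` the cokernel is always zero, so that truncation in `d - 1` plays no role. -/
structure IsAlmostGorensteinLocalRing (R : Type u) [CommRing R] : Prop
    extends IsCohenMacaulayLocalRing R where
  exists_embedding : ∃ (K : Type u) (_ : AddCommGroup K) (_ : Module R K),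
    IsCanonicalModule R K ∧
    ∃ φ : R →ₗ[R] K, Function.Injective φ ∧
      (Subsingleton (K ⧸ LinearMap.range φ) ∨
        (Nontrivial (K ⧸ LinearMap.range φ) ∧
          ∃ d : ℕ, ringKrullDim R = d ∧
            HasMultiplicity R (K ⧸ LinearMap.range φ) (d - 1)
              ((⊤ : Submodule R (K ⧸ LinearMap.range φ)).spanFinrank : ℝ)))

/-! Write 𝔪 for the maximal ideal of `R` and `A = R ⋉ I`. Some `x ∈ 𝔪` is regular on `R` and on
`R/I`. Finite injective dimension of `R` means injective dimension at most one, and for `N` killed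
by `x` one has `Hom(N, K/xK) ≅ Ext¹(N, K)`; so `R/xR` is self-injective with simple socle, and its
ideals are annihilators (`isInjectiveModulo_quotSMulTop`,
`IsInjectiveModulo.mem_of_forall_annihilator`). As `Ext¹(R/I, R) = 0`, also `Hom(I, R) = R/J`, and
`Hom_R(A, R) ≅ R ⊕ R/J` is a canonical module of `A` (`isCanonicalModule_dual`). In dimension one
the condition on the cokernel `C` just says that the maximal ideal kills `C`.

If `I + J = 𝔪`, then `x ∈ I + J` kills `I ∩ J`, so `I ∩ J = 0`. The map `A → R ⊕ R/J` with `1 ↦ (1,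
1)` is then injective, and its cokernel is killed by the maximal ideal
(`isAlmostGorenstein_of_sup_eq`).

Conversely, let `ξ ∈ K` be the image of `1` under a suitable embedding of `A` in a canonical module,
and let `𝔟` be the annihilator of `ξ` in `K/xK`. Then `A/𝔟` embeds in `K/xK` and so has simple
socle, while faithfulness of `K/xK` over `A/xA` puts `𝔟/xA` inside the socle of `A/xA`. Counting
socle elements (`dvd_mul_of_simple_socle`) gives `I ∩ (xR : I) ⊆ (xR : 𝔪)`. Annihilators in `R/xR`
turn this into `𝔪 ⊆ I + J + xR`; with `x²` in place of `x`, Nakayama gives `𝔪 ⊆ I + J`. -/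

/-! ### Injective dimension detected by `Ext` of cyclic modules and of the residue field. -/

section InjectiveDimension

variable {A : Type u} [CommRing A]

/-- The short complex of modules attached to an exact pair of linear maps. -/
abbrev exactPairComplex {M N P : Type u} [AddCommGroup M] [Module A M] [AddCommGroup N]
    [Module A N] [AddCommGroup P] [Module A P] {f : M →ₗ[A] N} {g : N →ₗ[A] P}
    (h : Function.Exact f g) : ShortComplex (ModuleCat.{u} A) :=
  ModuleCat.shortComplexOfCompEqZero f g h.linearMap_comp_eq_zero

lemma exactPairComplex_shortExact {M N P : Type u} [AddCommGroup M] [Module A M] [AddCommGroup N]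
    [Module A N] [AddCommGroup P] [Module A P] {f : M →ₗ[A] N} {g : N →ₗ[A] P}
    (h : Function.Exact f g) (hf : Function.Injective f) (hg : Function.Surjective g) :
    (exactPairComplex h).ShortExact :=
  ModuleCat.shortComplex_shortExact _ h hf hg

/-- A linear map on a submodule extends to the ambient module if the first `Ext` group of the
quotient vanishes. -/
lemma exists_extend_of_subsingleton_ext {N E : Type u} [AddCommGroup N] [Module A N]
    [AddCommGroup E] [Module A E] (P : Submodule A N)
    (h : Subsingleton (Ext (ModuleCat.of A (N ⧸ P)) (ModuleCat.of A E) 1)) (f : P →ₗ[A] E) :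
    ∃ g : N →ₗ[A] E, ∀ p : P, g p = f p := by
  have hS := exactPairComplex_shortExact (LinearMap.exact_subtype_mkQ P) P.injective_subtype
    P.mkQ_surjective
  obtain ⟨y, hy⟩ := Ext.contravariant_sequence_exact₁ hS (ModuleCat.of A E)
    (Ext.mk₀ (ModuleCat.ofHom f)) (n₁ := 1) rfl (h.elim _ _)
  obtain ⟨g, rfl⟩ := Ext.addEquiv₀.symm.surjective y
  refine ⟨g.hom, fun p => ?_⟩
  have h2 : ModuleCat.ofHom P.subtype ≫ g = ModuleCat.ofHom f := by
    apply Ext.addEquiv₀.symm.injective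
    simpa using hy
  exact congr($(h2).hom p)

/-- Baer's criterion in higher dimensions. -/
lemma hasInjectiveDimensionLT_of_subsingleton_ext_quotient (n : ℕ) (K : Type u) [AddCommGroup K]
    [Module A K]
    (h : ∀ 𝔞 : Ideal A, Subsingleton (Ext (ModuleCat.of A (A ⧸ 𝔞)) (ModuleCat.of A K) (n + 1))) :
    HasInjectiveDimensionLT (ModuleCat.of A K) (n + 1) := by
  induction n generalizing K with
  | zero =>
    rw [zero_add, ← injective_iff_hasInjectiveDimensionLT_one]
    rw [← Module.injective_iff_injective_object, ← Module.Baer.iff_injective]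
    intro 𝔞 g
    obtain ⟨g', hg'⟩ := exists_extend_of_subsingleton_ext 𝔞 (h 𝔞) g
    exact ⟨g', fun x hx => hg' ⟨x, hx⟩⟩
  | succ n ih =>
    let ⟨E, _, f, _⟩ := EnoughInjectives.presentation (ModuleCat.of A K)
    have injf : Function.Injective f.hom := (ModuleCat.mono_iff_injective f).mp ‹_›
    have hS := exactPairComplex_shortExact f.hom.exact_map_mkQ_range injf
      (Submodule.mkQ_surjective _)
    have : Injective (ModuleCat.of A E) := ‹Injective E›
    refine (hS.hasInjectiveDimensionLT_X₃_iff n this).mp (ih _ fun 𝔞 => ?_)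
    refine ⟨fun a b => ?_⟩
    rw [← sub_eq_zero]
    have h0 := h 𝔞
    obtain ⟨y, hy⟩ := Ext.covariant_sequence_exact₃ (ModuleCat.of A (A ⧸ 𝔞)) hS (a - b) rfl
      (h0.elim _ _)
    rw [← hy, Ext.eq_zero_of_injective y]
    simp

lemma subsingleton_ext_of_linearEquiv {M N : Type u} [AddCommGroup M] [Module A M]
    [AddCommGroup N] [Module A N] (e : M ≃ₗ[A] N) (K : ModuleCat.{u} A) (n : ℕ)
    (h : Subsingleton (Ext (ModuleCat.of A N) K n)) :
    Subsingleton (Ext (ModuleCat.of A M) K n) := by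
  refine subsingleton_of_forall_eq 0 fun x => ?_
  have hx : (Ext.mk₀ e.toModuleIso.hom).comp ((Ext.mk₀ e.toModuleIso.inv).comp x (zero_add n))
      (zero_add n) = x := by
    rw [Ext.mk₀_comp_mk₀_assoc, Iso.hom_inv_id, Ext.mk₀_id_comp]
  rw [← hx, h.elim ((Ext.mk₀ e.toModuleIso.inv).comp x (zero_add n)) 0, Ext.comp_zero]

lemma subsingleton_ext_middle {M N P : Type u} [AddCommGroup M] [Module A M] [AddCommGroup N]
    [Module A N] [AddCommGroup P] [Module A P] {f : M →ₗ[A] N} {g : N →ₗ[A] P}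
    (h : Function.Exact f g) (hf : Function.Injective f) (hg : Function.Surjective g)
    (K : ModuleCat.{u} A) (n : ℕ) (h₁ : Subsingleton (Ext (ModuleCat.of A M) K n))
    (h₃ : Subsingleton (Ext (ModuleCat.of A P) K n)) :
    Subsingleton (Ext (ModuleCat.of A N) K n) := by
  have hS := exactPairComplex_shortExact h hf hg
  refine subsingleton_of_forall_eq 0 fun x => ?_
  obtain ⟨y, rfl⟩ := Ext.contravariant_sequence_exact₂ hS K x (h₁.elim _ _)
  rw [h₃.elim y 0]
  simp

lemma subsingleton_ext_left {M N P : Type u} [AddCommGroup M] [Module A M] [AddCommGroup N]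
    [Module A N] [AddCommGroup P] [Module A P] {f : M →ₗ[A] N} {g : N →ₗ[A] P}
    (h : Function.Exact f g) (hf : Function.Injective f) (hg : Function.Surjective g)
    (K : ModuleCat.{u} A) (n : ℕ) (h₂ : Subsingleton (Ext (ModuleCat.of A N) K n))
    (h₃ : Subsingleton (Ext (ModuleCat.of A P) K (n + 1))) :
    Subsingleton (Ext (ModuleCat.of A M) K n) := by
  have hS := exactPairComplex_shortExact h hf hg
  refine subsingleton_of_forall_eq 0 fun x => ?_
  obtain ⟨y, rfl⟩ := Ext.contravariant_sequence_exact₁ hS K x (add_comm 1 n) (h₃.elim _ _)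
  rw [h₂.elim y 0]
  simp

lemma subsingleton_ext_right {M N P : Type u} [AddCommGroup M] [Module A M] [AddCommGroup N]
    [Module A N] [AddCommGroup P] [Module A P] {f : M →ₗ[A] N} {g : N →ₗ[A] P}
    (h : Function.Exact f g) (hf : Function.Injective f) (hg : Function.Surjective g)
    (K : ModuleCat.{u} A) (n : ℕ) (h₁ : Subsingleton (Ext (ModuleCat.of A M) K n))
    (h₂ : Subsingleton (Ext (ModuleCat.of A N) K (n + 1))) :
    Subsingleton (Ext (ModuleCat.of A P) K (n + 1)) := by
  have hS := exactPairComplex_shortExact h hf hg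
  refine subsingleton_of_forall_eq 0 fun x => ?_
  obtain ⟨y, rfl⟩ := Ext.contravariant_sequence_exact₃ hS K x (h₂.elim _ _) (add_comm 1 n)
  rw [h₁.elim y 0]
  simp

/-- If `x` is regular on `M`, then `Ext^n(M, K)` vanishes as soon as
`Ext^{n+1}(M/xM, K)` does. -/
lemma subsingleton_ext_of_isSMulRegular [IsLocalRing A] [IsNoetherianRing A] {M K : Type u}
    [AddCommGroup M] [Module A M] [Module.Finite A M] [AddCommGroup K] [Module A K]
    [Module.Finite A K] {x : A} (hx : x ∈ IsLocalRing.maximalIdeal A) (hreg : IsSMulRegular M x)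
    (n : ℕ) (h : Subsingleton (Ext (ModuleCat.of A (QuotSMulTop x M)) (ModuleCat.of A K) (n + 1))) :
    Subsingleton (Ext (ModuleCat.of A M) (ModuleCat.of A K) n) := by
  have hS := IsSMulRegular.smulShortComplex_shortExact (M := ModuleCat.of A M) hreg
  -- Vanishing of the next `Ext` makes multiplication by `x` surjective on `Ext^n(M, K)`, which is
  -- finitely generated, so Nakayama applies.
  have htop : (⊤ : Submodule A (Ext (ModuleCat.of A M) (ModuleCat.of A K) n)) ≤
      Ideal.span {x} • ⊤ := by
    intro y _
    obtain ⟨z, rfl⟩ := Ext.contravariant_sequence_exact₁ hS (ModuleCat.of A K) y (add_comm 1 n)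
      (h.elim _ _)
    have hz : ∀ z : Ext (ModuleCat.of A M) (ModuleCat.of A K) n,
        (Ext.mk₀ (x • 𝟙 (ModuleCat.of A M))).comp z (zero_add n) = x • z := fun z => by
      rw [Ext.mk₀_smul, Ext.smul_comp, Ext.mk₀_id_comp]
    exact (hz z).symm ▸ Submodule.smul_mem_smul (Ideal.mem_span_singleton_self x) trivial
  have := Submodule.eq_bot_of_le_smul_of_le_jacobson_bot (Ideal.span {x})
    (⊤ : Submodule A (Ext (ModuleCat.of A M) (ModuleCat.of A K) n)) (Module.Finite.fg_top) htop
    (by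
      rw [IsLocalRing.jacobson_eq_maximalIdeal _ bot_ne_top, Ideal.span_singleton_le_iff_mem]
      exact hx)
  exact (Submodule.subsingleton_iff A).mp (subsingleton_of_bot_eq_top this.symm)

/-- A prime filtration reduces the vanishing of `Ext^{n+1}(N, K)` to `N = A/𝔭`. For `𝔭` not maximal,
an element of the maximal ideal outside `𝔭` is regular on `A/𝔭`, and `Ext^{n+2} = 0` suffices. The
index in `HasInjectiveDimensionLT` is one more than the bound, so this lowers the bound from `n + 1`
to `n`. -/
lemma hasInjectiveDimensionLT_of_subsingleton_ext_residueField [IsLocalRing A] [IsNoetherianRing A]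
    (K : Type u) [AddCommGroup K] [Module A K] [Module.Finite A K] (n : ℕ)
    (hK : HasInjectiveDimensionLT (ModuleCat.of A K) (n + 2))
    (h : Subsingleton (Ext (ModuleCat.of A (IsLocalRing.ResidueField A)) (ModuleCat.of A K)
      (n + 1))) :
    HasInjectiveDimensionLT (ModuleCat.of A K) (n + 1) := by
  suffices ∀ (N : Type u) [AddCommGroup N] [Module A N] (_ : Module.Finite A N),
      Subsingleton (Ext (ModuleCat.of A N) (ModuleCat.of A K) (n + 1)) from
    hasInjectiveDimensionLT_of_subsingleton_ext_quotient n K fun 𝔞 => this _ inferInstance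
  intro N _ _ hN
  induction hN using
    IsNoetherianRing.induction_on_isQuotientEquivQuotientPrime A with
  | subsingleton N =>
    refine subsingleton_of_forall_eq 0 fun x => ?_
    rw [← Ext.mk₀_id_comp x, (ModuleCat.isZero_of_subsingleton (ModuleCat.of A N)).eq_of_src
      (𝟙 (ModuleCat.of A N)) 0, Ext.mk₀_zero, Ext.zero_comp]
  | quotient N p e =>
    by_cases hp : p.1 = IsLocalRing.maximalIdeal A
    · have e' : N ≃ₗ[A] IsLocalRing.ResidueField A :=
        e.trans (Submodule.quotEquivOfEq _ _ hp)
      exact subsingleton_ext_of_linearEquiv e' _ _ h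
    · obtain ⟨x, hx, hxp⟩ : ∃ x ∈ IsLocalRing.maximalIdeal A, x ∉ p.1 := by
        by_contra! hc
        exact hp (le_antisymm (IsLocalRing.le_maximalIdeal p.2.ne_top) hc)
      refine subsingleton_ext_of_isSMulRegular hx (fun a b hab => ?_) _ ?_
      · apply e.injective
        have : x • (e a - e b) = 0 := by
          rw [← map_sub, ← map_smul, smul_sub, sub_eq_zero.mpr hab, map_zero]
        rw [← sub_eq_zero]
        generalize e a - e b = c at this
        obtain ⟨c, rfl⟩ := Ideal.Quotient.mk_surjective c
        rw [← Ideal.Quotient.mk_eq_mk, ← Submodule.Quotient.mk_smul,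
          Submodule.Quotient.mk_eq_zero] at this
        rw [Ideal.Quotient.eq_zero_iff_mem]
        exact (p.2.mem_or_mem this).resolve_left hxp
      · exact HasInjectiveDimensionLT.subsingleton _ (n + 2) _ le_rfl _
  | exact N₁ N₂ N₃ f g hf hg hfg h₁ h₃ =>
    exact subsingleton_ext_middle hfg hf hg _ _ h₁ h₃

/-- If the residue field embeds in `M` and the higher `Ext` groups `Ext^i(M, K)` vanish for `i > n`,
then a finitely generated `K` of finite injective dimension has injective dimension at most `n`. -/
lemma hasInjectiveDimensionLE_of_residueField_embeds [IsLocalRing A] [IsNoetherianRing A]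
    (K : Type u) [AddCommGroup K] [Module A K] [Module.Finite A K]
    (hK : ∃ m : ℕ, HasInjectiveDimensionLE (ModuleCat.of A K) m)
    {M : Type u} [AddCommGroup M] [Module A M] (f : IsLocalRing.ResidueField A →ₗ[A] M)
    (hf : Function.Injective f) (n : ℕ)
    (hM : ∀ i, n < i → Subsingleton (Ext (ModuleCat.of A M) (ModuleCat.of A K) i)) :
    HasInjectiveDimensionLE (ModuleCat.of A K) n := by
  have key (j : ℕ) : HasInjectiveDimensionLE (ModuleCat.of A K) (n + j) →
      HasInjectiveDimensionLE (ModuleCat.of A K) n := by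
    induction j with
    | zero => exact id
    | succ j ih =>
      intro h
      refine ih (hasInjectiveDimensionLT_of_subsingleton_ext_residueField K (n + j) h ?_)
      exact subsingleton_ext_left f.exact_map_mkQ_range hf (Submodule.mkQ_surjective _) _ _
        (hM _ (by lia)) (HasInjectiveDimensionLT.subsingleton _ (n + j + 2) _ le_rfl _)
  obtain ⟨m, hm⟩ := hK
  exact key m (hasInjectiveDimensionLT_of_ge _ (m + 1) _ (by lia))

end InjectiveDimension

/-! ### Self-injectivity modulo a regular element, socles and annihilators. -/

section RelativeInjectivity

variable {A : Type u} [CommRing A]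

/-- Homomorphisms from a module killed by a `K`-regular element `x` to `K/xK` are first extensions
by `K`. -/
noncomputable def homQuotSMulTopEquivExt {K N : Type u} [AddCommGroup K] [Module A K]
    [AddCommGroup N] [Module A N] {x : A} (hreg : IsSMulRegular K x) (hN : ∀ v : N, x • v = 0) :
    (N →ₗ[A] QuotSMulTop x K) ≃ₗ[A] Ext (ModuleCat.of A N) (ModuleCat.of A K) 1 :=
  LinearEquiv.ofBijective
    (((IsSMulRegular.smulShortComplex_shortExact (M := ModuleCat.of A K)
      hreg).extClass.postcompOfLinear A (ModuleCat.of A N) (zero_add 1)) ∘ₗ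
      (Ext.linearEquiv₀ (R := A)).symm.toLinearMap ∘ₗ
        (ModuleCat.homLinearEquiv (S := A) (M := ModuleCat.of A N)
          (N := ModuleCat.of A (QuotSMulTop x K))).symm.toLinearMap) (by
    constructor
    · rw [injective_iff_map_eq_zero]
      intro f hf
      obtain ⟨y, hy⟩ := Ext.covariant_sequence_exact₃ (ModuleCat.of A N)
        (IsSMulRegular.smulShortComplex_shortExact (M := ModuleCat.of A K) hreg)
        (Ext.mk₀ (ModuleCat.ofHom f)) (zero_add 1) hf
      obtain ⟨g, rfl⟩ := Ext.addEquiv₀.symm.surjective y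
      -- `Hom(N, K) = 0`: `x` kills `N` and is regular on `K`.
      have hg : g = 0 := by
        ext v
        apply hreg
        change x • g.hom v = x • (0 : K)
        rw [← map_smul, hN, map_zero, smul_zero]
        rfl
      rw [hg, map_zero, Ext.zero_comp] at hy
      exact congr($(Ext.addEquiv₀.symm.injective (hy.symm.trans (map_zero _).symm)).hom)
    · intro y
      -- Multiplication by `x` on `Ext¹(N, K)` can be computed on `N`, where it is zero; so every
      -- class comes from the connecting map.
      obtain ⟨z, hz⟩ := Ext.covariant_sequence_exact₁ (ModuleCat.of A N)
        (IsSMulRegular.smulShortComplex_shortExact (M := ModuleCat.of A K) hreg) y (by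
          have h1 : (y.comp (Ext.mk₀ (x • 𝟙 (ModuleCat.of A K))) (add_zero 1)) = x • y :=
            (Ext.smul_eq_comp_mk₀ y x).symm
          have h2 : x • y = (Ext.mk₀ (x • 𝟙 (ModuleCat.of A N))).comp y (zero_add 1) := by
            rw [Ext.mk₀_smul, Ext.smul_comp, Ext.mk₀_id_comp]
          have h3 : x • 𝟙 (ModuleCat.of A N) = 0 := by
            ext v
            exact hN v
          refine h1.trans ?_
          rw [h2, h3, Ext.mk₀_zero, Ext.zero_comp]
          rfl) (zero_add 1)
      refine ⟨(Ext.addEquiv₀ z).hom, ?_⟩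
      rw [← hz]
      exact congr(Ext.comp $(Ext.addEquiv₀.symm_apply_apply z) _ _))

lemma homQuotSMulTopEquivExt_comp {K N P : Type u} [AddCommGroup K] [Module A K]
    [AddCommGroup N] [Module A N] [AddCommGroup P] [Module A P] {x : A}
    (hreg : IsSMulRegular K x) (hN : ∀ v : N, x • v = 0) (hP : ∀ v : P, x • v = 0)
    (i : P →ₗ[A] N) (g : N →ₗ[A] QuotSMulTop x K) :
    homQuotSMulTopEquivExt hreg hP (g ∘ₗ i) =
      (Ext.mk₀ (ModuleCat.ofHom i)).comp (homQuotSMulTopEquivExt hreg hN g) (zero_add 1) := by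
  let d := (IsSMulRegular.smulShortComplex_shortExact (M := ModuleCat.of A K) hreg).extClass
  change (Ext.mk₀ (ModuleCat.ofHom i ≫ ModuleCat.ofHom g)).comp d (zero_add 1) =
    (Ext.mk₀ (ModuleCat.ofHom i)).comp ((Ext.mk₀ (ModuleCat.ofHom g)).comp d (zero_add 1))
      (zero_add 1)
  exact (Ext.mk₀_comp_mk₀_assoc _ _ _).symm

/-- `E` has the extension property of injective modules with respect to modules killed by `x`. -/
def IsInjectiveModulo (x : A) (E : Type u) [AddCommGroup E] [Module A E] : Prop :=
  ∀ (N : Type u) [AddCommGroup N] [Module A N] (P : Submodule A N), (∀ v : N, x • v = 0) →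
    ∀ f : P →ₗ[A] E, ∃ g : N →ₗ[A] E, ∀ p : P, g p = f p

/-- Under `homQuotSMulTopEquivExt`, extending a map from `P` to `N` becomes lifting a class along
`Ext¹(N, K) → Ext¹(P, K)`; the obstruction lies in `Ext²(N/P, K) = 0`. -/
lemma isInjectiveModulo_quotSMulTop {K : Type u} [AddCommGroup K] [Module A K] {x : A}
    (hreg : IsSMulRegular K x) (hK : HasInjectiveDimensionLE (ModuleCat.of A K) 1) :
    IsInjectiveModulo x (QuotSMulTop x K) := by
  intro N _ _ P hN f
  have hP : ∀ v : P, x • v = 0 := fun v => Subtype.ext (hN v)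
  have hS := exactPairComplex_shortExact (LinearMap.exact_subtype_mkQ P) P.injective_subtype
    P.mkQ_surjective
  have hext := HasInjectiveDimensionLT.subsingleton (ModuleCat.of A K) 2 2 le_rfl
    (ModuleCat.of A (N ⧸ P))
  obtain ⟨y, hy⟩ := Ext.contravariant_sequence_exact₁ hS (ModuleCat.of A K)
    (homQuotSMulTopEquivExt hreg hP f) (n₁ := 2) rfl (hext.elim _ _)
  obtain ⟨g, rfl⟩ := (homQuotSMulTopEquivExt hreg hN).surjective y
  refine ⟨g, fun p => ?_⟩
  have h := (homQuotSMulTopEquivExt_comp hreg hN hP P.subtype g).trans hy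
  exact congr($((homQuotSMulTopEquivExt hreg hP).injective h) p)

lemma IsInjectiveModulo.exists_map {x : A} {E : Type u} [AddCommGroup E] [Module A E]
    (hE : IsInjectiveModulo x E) {N : Type u} [AddCommGroup N] [Module A N]
    (hN : ∀ v : N, x • v = 0) (v : N) (w : E) (h : ∀ a : A, a • v = 0 → a • w = 0) :
    ∃ f : N →ₗ[A] E, f v = w := by
  let p := LinearMap.toSpanSingleton A N v
  let q := LinearMap.toSpanSingleton A E w
  have hpq : LinearMap.ker p ≤ LinearMap.ker q := fun a ha => h a ha
  obtain ⟨g, hg⟩ := hE N (LinearMap.range p) hN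
    ((LinearMap.ker p).liftQ q hpq ∘ₗ p.quotKerEquivRange.symm.toLinearMap)
  refine ⟨g, ?_⟩
  have h1 := hg ⟨p 1, 1, rfl⟩
  have h2 : p.quotKerEquivRange.symm ⟨p 1, 1, rfl⟩ = (LinearMap.ker p).mkQ 1 := by
    rw [LinearEquiv.symm_apply_eq]
    rfl
  rw [LinearMap.comp_apply, LinearEquiv.coe_coe, h2] at h1
  have h3 : g (p 1) = q 1 := h1
  rwa [LinearMap.toSpanSingleton_apply, LinearMap.toSpanSingleton_apply, one_smul, one_smul] at h3

/-- A module with the extension property and a nonzero socle separates points. -/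
lemma IsInjectiveModulo.exists_map_ne_zero [IsLocalRing A] {x : A} {E : Type u} [AddCommGroup E]
    [Module A E] (hE : IsInjectiveModulo x E) {s : E} (hs : s ≠ 0)
    (hms : ∀ c ∈ IsLocalRing.maximalIdeal A, c • s = 0) {N : Type u} [AddCommGroup N]
    [Module A N] (hN : ∀ v : N, x • v = 0) {v : N} (hv : v ≠ 0) : ∃ f : N →ₗ[A] E, f v ≠ 0 := by
  obtain ⟨f, hf⟩ := hE.exists_map hN v s fun a ha => by
    by_cases hm : a ∈ IsLocalRing.maximalIdeal A
    · exact hms a hm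
    · have hu : IsUnit a := by simpa using hm
      exact absurd (hu.smul_eq_zero.mp ha) hv
  exact ⟨f, hf ▸ hs⟩

/-- The homomorphism from the residue field given by an element killed by the maximal ideal. -/
noncomputable def residueFieldMap [IsLocalRing A] {E : Type u} [AddCommGroup E] [Module A E] (w : E)
    (hw : ∀ c ∈ IsLocalRing.maximalIdeal A, c • w = 0) : IsLocalRing.ResidueField A →ₗ[A] E :=
  (IsLocalRing.maximalIdeal A).liftQ (LinearMap.toSpanSingleton A E w) hw

lemma residueFieldMap_one [IsLocalRing A] {E : Type u} [AddCommGroup E] [Module A E] (w : E)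
    (hw : ∀ c ∈ IsLocalRing.maximalIdeal A, c • w = 0) : residueFieldMap w hw 1 = w := by
  change LinearMap.toSpanSingleton A E w 1 = w
  rw [LinearMap.toSpanSingleton_apply, one_smul]

lemma residueField_smul_one [IsLocalRing A] (c : IsLocalRing.ResidueField A) :
    ∃ a : A, c = a • (1 : IsLocalRing.ResidueField A) := by
  obtain ⟨a, rfl⟩ := IsLocalRing.residue_surjective c
  exact ⟨a, by rw [Algebra.smul_def, mul_one]; rfl⟩

lemma residueField_hom_ext [IsLocalRing A] {E : Type u} [AddCommGroup E] [Module A E]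
    {f g : IsLocalRing.ResidueField A →ₗ[A] E} (h : f 1 = g 1) : f = g := by
  ext c
  obtain ⟨a, rfl⟩ := residueField_smul_one c
  rw [map_smul, map_smul, h]

lemma smul_residueField_eq_zero [IsLocalRing A] {x : A} (hx : x ∈ IsLocalRing.maximalIdeal A)
    (v : IsLocalRing.ResidueField A) : x • v = 0 := by
  rw [Algebra.smul_def, IsLocalRing.ResidueField.algebraMap_eq,
    (IsLocalRing.residue_eq_zero_iff x).mpr hx, zero_mul]

lemma residueFieldMap_injective [IsLocalRing A] {E : Type u} [AddCommGroup E] [Module A E] {w : E}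
    (hw : ∀ c ∈ IsLocalRing.maximalIdeal A, c • w = 0) (h0 : w ≠ 0) :
    Function.Injective (residueFieldMap w hw) := by
  rw [injective_iff_map_eq_zero]
  intro c hc
  obtain ⟨a, rfl⟩ := residueField_smul_one c
  rw [map_smul, residueFieldMap_one] at hc
  by_cases hm : a ∈ IsLocalRing.maximalIdeal A
  · exact smul_residueField_eq_zero hm 1
  · have hu : IsUnit a := by simpa using hm
    exact absurd (hu.smul_eq_zero.mp hc) h0

/-- In type one, the socle of `K/xK` is generated by each of its nonzero elements. -/
lemma exists_smul_eq_of_ext_equiv [IsLocalRing A] {K : Type u} [AddCommGroup K] [Module A K] {x : A}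
    (hx : x ∈ IsLocalRing.maximalIdeal A) (hreg : IsSMulRegular K x)
    (e : Ext (ModuleCat.of A (IsLocalRing.ResidueField A)) (ModuleCat.of A K) 1
      ≃ₗ[A] IsLocalRing.ResidueField A) {v w : QuotSMulTop x K}
    (hv : ∀ c ∈ IsLocalRing.maximalIdeal A, c • v = 0)
    (hw : ∀ c ∈ IsLocalRing.maximalIdeal A, c • w = 0) (h0 : v ≠ 0) : ∃ a : A, w = a • v := by
  let E := (homQuotSMulTopEquivExt hreg (smul_residueField_eq_zero hx)).trans e
  have h1 : E (residueFieldMap v hv) ≠ 0 := fun h => by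
    rw [LinearEquiv.map_eq_zero_iff] at h
    exact h0 (by rw [← residueFieldMap_one v hv, h, LinearMap.zero_apply])
  obtain ⟨a, ha⟩ := residueField_smul_one (E (residueFieldMap w hw) / E (residueFieldMap v hv))
  have h2 : E (residueFieldMap w hw) = E (a • residueFieldMap v hv) := by
    rw [map_smul, ← div_mul_cancel₀ (E (residueFieldMap w hw)) h1, ha, smul_mul_assoc, one_mul]
  refine ⟨a, ?_⟩
  rw [← residueFieldMap_one w hw, E.injective h2, LinearMap.smul_apply, residueFieldMap_one]

/-- If the socle of `K/xK` is simple then `K` has type one. -/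
lemma nonempty_ext_equiv_of_socle [IsLocalRing A] {K : Type u} [AddCommGroup K] [Module A K] {x : A}
    (hx : x ∈ IsLocalRing.maximalIdeal A) (hreg : IsSMulRegular K x) {v : QuotSMulTop x K}
    (hv : ∀ c ∈ IsLocalRing.maximalIdeal A, c • v = 0) (h0 : v ≠ 0)
    (h : ∀ w : QuotSMulTop x K, (∀ c ∈ IsLocalRing.maximalIdeal A, c • w = 0) →
      ∃ a : A, w = a • v) :
    Nonempty (Ext (ModuleCat.of A (IsLocalRing.ResidueField A)) (ModuleCat.of A K) 1
      ≃ₗ[A] IsLocalRing.ResidueField A) := by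
  have hf : ∀ c ∈ IsLocalRing.maximalIdeal A, c • residueFieldMap v hv = 0 := fun c hc =>
    residueField_hom_ext (by
      rw [LinearMap.smul_apply, residueFieldMap_one, hv c hc, LinearMap.zero_apply])
  have hne : residueFieldMap v hv ≠ 0 := fun h =>
    h0 (by rw [← residueFieldMap_one v hv, h, LinearMap.zero_apply])
  refine ⟨((LinearEquiv.ofBijective (residueFieldMap (residueFieldMap v hv) hf)
    ⟨residueFieldMap_injective hf hne, fun g => ?_⟩).trans
    (homQuotSMulTopEquivExt hreg (smul_residueField_eq_zero hx))).symm⟩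
  obtain ⟨a, ha⟩ := h (g 1) fun c hc => by
    rw [← map_smul, smul_residueField_eq_zero hc, map_zero]
  refine ⟨a • 1, residueField_hom_ext ?_⟩
  rw [map_smul, residueFieldMap_one, LinearMap.smul_apply, residueFieldMap_one, ha]

lemma quotSMulTop_mk_eq_zero_iff {K : Type u} [AddCommGroup K] [Module A K] {x : A} {v : K} :
    (Submodule.Quotient.mk v : QuotSMulTop x K) = 0 ↔ ∃ w : K, x • w = v := by
  rw [Submodule.Quotient.mk_eq_zero, Submodule.mem_smul_pointwise_iff_exists]
  simp

lemma quotSMulTop_mk_self_eq_zero_iff {x v : A} :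
    (Submodule.Quotient.mk v : QuotSMulTop x A) = 0 ↔ x ∣ v := by
  rw [quotSMulTop_mk_eq_zero_iff, dvd_iff_exists_eq_mul_right]
  simp [eq_comm]

lemma smul_quotSMulTop_eq_zero {K : Type u} [AddCommGroup K] [Module A K] {x : A}
    (v : QuotSMulTop x K) : x • v = 0 := by
  obtain ⟨v, rfl⟩ := Submodule.Quotient.mk_surjective _ v
  rw [← Submodule.Quotient.mk_smul, quotSMulTop_mk_eq_zero_iff]
  exact ⟨v, rfl⟩

/-- Principal ideals of a self-injective ring `A/x` are determined by their annihilators. -/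
lemma IsInjectiveModulo.exists_dvd_sub {x : A} (hA : IsInjectiveModulo x (QuotSMulTop x A))
    {s t : A} (h : ∀ c, x ∣ c * s → x ∣ c * t) : ∃ r, x ∣ t - r * s := by
  obtain ⟨f, hf⟩ := hA.exists_map smul_quotSMulTop_eq_zero
    (Submodule.Quotient.mk s) (Submodule.Quotient.mk t) fun a ha => by
      rw [← Submodule.Quotient.mk_smul, quotSMulTop_mk_self_eq_zero_iff] at ha ⊢
      exact h a ha
  obtain ⟨r, hr⟩ := Submodule.Quotient.mk_surjective _ (f (Submodule.Quotient.mk 1))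
  refine ⟨r, ?_⟩
  rw [← quotSMulTop_mk_self_eq_zero_iff, Submodule.Quotient.mk_sub, ← hf, sub_eq_zero,
    mul_comm r s, ← smul_eq_mul s r, Submodule.Quotient.mk_smul, hr, ← map_smul,
    ← Submodule.Quotient.mk_smul, smul_eq_mul, mul_one]

/-- In a self-injective ring `A/x`, the annihilator of an intersection is the sum of the
annihilators. -/
lemma IsInjectiveModulo.exists_add_of_inf {x : A} (hA : IsInjectiveModulo x (QuotSMulTop x A))
    {P Q : Ideal A} (hP : x ∈ P) (hQ : x ∈ Q) {c : A} (hc : ∀ p ∈ P ⊓ Q, x ∣ p * c) :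
    ∃ c₁ c₂, x ∣ c - (c₁ + c₂) ∧ (∀ p ∈ P, x ∣ p * c₁) ∧ ∀ q ∈ Q, x ∣ q * c₂ := by
  have hk : ∀ (𝔞 : Ideal A) (a : A), a ∈ 𝔞 ↔ a • (Submodule.Quotient.mk 1 : A ⧸ 𝔞) = 0 :=
    fun 𝔞 a => by
      rw [← Submodule.Quotient.mk_smul, smul_eq_mul, mul_one, Submodule.Quotient.mk_eq_zero]
  have hz : ∀ (𝔞 : Ideal A), x ∈ 𝔞 → ∀ v : A ⧸ 𝔞, x • v = 0 := fun 𝔞 h v => by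
    obtain ⟨v, rfl⟩ := Submodule.Quotient.mk_surjective _ v
    rw [← Submodule.Quotient.mk_smul, Submodule.Quotient.mk_eq_zero]
    exact 𝔞.mul_mem_right v h
  -- The vector `(1, 1)` has annihilator `P ∩ Q`, so it can be sent to `c`; then `c = f(1, 0) + f(0,
  -- 1)` is the required splitting.
  obtain ⟨f, hf⟩ := hA.exists_map (N := (A ⧸ P) × (A ⧸ Q))
    (fun v => Prod.ext (hz P hP v.1) (hz Q hQ v.2))
    (Submodule.Quotient.mk 1, Submodule.Quotient.mk 1) (Submodule.Quotient.mk c) fun a ha => by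
      rw [← Submodule.Quotient.mk_smul, quotSMulTop_mk_self_eq_zero_iff]
      exact hc a ⟨(hk P a).mpr congr($(ha).1), (hk Q a).mpr congr($(ha).2)⟩
  obtain ⟨c₁, h₁⟩ := Submodule.Quotient.mk_surjective _ (f (Submodule.Quotient.mk 1, 0))
  obtain ⟨c₂, h₂⟩ := Submodule.Quotient.mk_surjective _ (f (0, Submodule.Quotient.mk 1))
  refine ⟨c₁, c₂, ?_, fun p hp => ?_, fun q hq => ?_⟩
  · rw [← quotSMulTop_mk_self_eq_zero_iff, Submodule.Quotient.mk_sub, Submodule.Quotient.mk_add,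
      h₁, h₂, ← map_add, Prod.mk_add_mk, add_zero, zero_add, hf, sub_self]
  · rw [← quotSMulTop_mk_self_eq_zero_iff, ← smul_eq_mul, Submodule.Quotient.mk_smul, h₁,
      ← map_smul, Prod.smul_mk, (hk P p).mp hp, smul_zero]
    exact map_zero f
  · rw [← quotSMulTop_mk_self_eq_zero_iff, ← smul_eq_mul, Submodule.Quotient.mk_smul, h₂,
      ← map_smul, Prod.smul_mk, (hk Q q).mp hq, smul_zero]
    exact map_zero f

/-- In a self-injective local ring `A/x` with nonzero socle, every ideal is an annihilator. -/
lemma IsInjectiveModulo.mem_of_forall_annihilator [IsLocalRing A] {x : A}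
    (hA : IsInjectiveModulo x (QuotSMulTop x A)) {s : A} (hs : ¬ x ∣ s)
    (hms : ∀ c ∈ IsLocalRing.maximalIdeal A, x ∣ c * s) {P : Ideal A} (hP : x ∈ P) {c : A}
    (hc : ∀ t, (∀ p ∈ P, x ∣ p * t) → x ∣ c * t) : c ∈ P := by
  by_contra hcP
  -- A map `A/P → A/x` is multiplication by some `t` annihilating `P` modulo `x`. One that is
  -- nonzero at `c` contradicts `hc`.
  obtain ⟨f, hf⟩ := hA.exists_map_ne_zero (s := Submodule.Quotient.mk s)
    (mt quotSMulTop_mk_self_eq_zero_iff.mp hs) (fun c hc => by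
      rw [← Submodule.Quotient.mk_smul, quotSMulTop_mk_self_eq_zero_iff]
      exact hms c hc) (N := A ⧸ P) (fun v => by
        obtain ⟨v, rfl⟩ := Submodule.Quotient.mk_surjective _ v
        rw [← Submodule.Quotient.mk_smul, Submodule.Quotient.mk_eq_zero]
        exact P.mul_mem_right v hP) (v := Submodule.Quotient.mk c)
    (mt (Submodule.Quotient.mk_eq_zero P).mp hcP)
  obtain ⟨t, ht⟩ := Submodule.Quotient.mk_surjective _ (f (Submodule.Quotient.mk 1))
  have key : ∀ a : A, Submodule.Quotient.mk (a * t) = f (Submodule.Quotient.mk a) := fun a => by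
    rw [← smul_eq_mul, Submodule.Quotient.mk_smul, ht, ← map_smul, ← Submodule.Quotient.mk_smul,
      smul_eq_mul, mul_one]
  refine hf ?_
  rw [← key, quotSMulTop_mk_self_eq_zero_iff]
  refine hc t fun p hp => ?_
  rw [← quotSMulTop_mk_self_eq_zero_iff, key, (Submodule.Quotient.mk_eq_zero P).mpr hp, map_zero]

end RelativeInjectivity

/-! ### Regular elements, depth and injective dimension over one-dimensional local rings. -/

section DimensionOne

variable {A : Type u} [CommRing A]

lemma exists_maximalIdeal_pow_le_span [IsLocalRing A] [IsNoetherianRing A]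
    (hd : ringKrullDim A = 1) {x : A} (hx : x ∈ IsLocalRing.maximalIdeal A)
    (hreg : IsSMulRegular A x) : ∃ j : ℕ, IsLocalRing.maximalIdeal A ^ j ≤ Ideal.span {x} := by
  have h0 : ringKrullDim (A ⧸ Ideal.span {x}) = 0 := by
    have h := ringKrullDim_quotient_span_singleton_succ_eq_ringKrullDim hreg hx
    rw [hd] at h
    generalize ringKrullDim (A ⧸ Ideal.span {x}) = e at h ⊢
    induction e with
    | bot => simp at h
    | coe e =>
      induction e with
      | top =>
        have h' : (⊤ + 1 : ℕ∞) = 1 := by exact_mod_cast h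
        simp at h'
      | coe e =>
        norm_cast at h ⊢
        lia
  have : Ring.KrullDimLE 0 (A ⧸ Ideal.span {x}) := by
    rw [Ring.krullDimLE_iff, h0]
    rfl
  have hrad : IsLocalRing.maximalIdeal A ≤ (Ideal.span {x}).radical := by
    rw [Ideal.radical_eq_sInf]
    refine le_sInf fun p hp => ?_
    obtain ⟨hxp, hp⟩ := hp
    have hprime : (p.map (Ideal.Quotient.mk (Ideal.span {x}))).IsPrime :=
      Ideal.map_isPrime_of_surjective Ideal.Quotient.mk_surjective (by simpa using hxp)
    have hmax := Ideal.IsPrime.isMaximal' (I := p.map (Ideal.Quotient.mk (Ideal.span {x})))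
    have hc : (p.map (Ideal.Quotient.mk (Ideal.span {x}))).comap
        (Ideal.Quotient.mk (Ideal.span {x})) = p := by
      rw [Ideal.comap_map_of_surjective _ Ideal.Quotient.mk_surjective, ← RingHom.ker_eq_comap_bot,
        Ideal.mk_ker]
      exact sup_eq_left.mpr hxp
    have : p.IsMaximal := hc ▸ Ideal.comap_isMaximal_of_surjective _ Ideal.Quotient.mk_surjective
    exact (IsLocalRing.eq_maximalIdeal this).ge
  exact Ideal.exists_pow_le_of_le_radical_of_fg hrad (IsNoetherian.noetherian _)

/-- An element outside a submodule containing a power of the maximal ideal times it has a multiple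
in the socle of the quotient. -/
lemma exists_smul_socle [IsLocalRing A] {N : Type*} [AddCommGroup N] [Module A N]
    (U : Submodule A N) {v : N} (hv : v ∉ U) {j : ℕ}
    (hj : ∀ c ∈ IsLocalRing.maximalIdeal A ^ j, c • v ∈ U) :
    ∃ r : A, r • v ∉ U ∧ ∀ c ∈ IsLocalRing.maximalIdeal A, c • r • v ∈ U := by
  induction j with
  | zero => exact absurd (by simpa using hj 1 (by simp)) hv
  | succ j ih =>
    by_cases h : ∀ c ∈ IsLocalRing.maximalIdeal A ^ j, c • v ∈ U
    · exact ih h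
    · push Not at h
      obtain ⟨r, hr, hrv⟩ := h
      refine ⟨r, hrv, fun c hc => ?_⟩
      rw [← mul_smul]
      refine hj _ ?_
      rw [pow_succ, mul_comm c r]
      exact Ideal.mul_mem_mul hr hc

/-- Either the maximal ideal contains an `M`-regular element or the residue field embeds in `M`. -/
lemma exists_isSMulRegular_or_socle [IsLocalRing A] [IsNoetherianRing A] (M : Type u)
    [AddCommGroup M] [Module A M] [Module.Finite A M] :
    (∃ x ∈ IsLocalRing.maximalIdeal A, IsSMulRegular M x) ∨
      ∃ v : M, v ≠ 0 ∧ ∀ c ∈ IsLocalRing.maximalIdeal A, c • v = 0 := by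
  by_cases h : Subsingleton (IsLocalRing.ResidueField A →ₗ[A] M)
  · left
    obtain ⟨x, hx, hreg⟩ := IsSMulRegular.subsingleton_linearMap_iff.mp h
    refine ⟨x, ?_, hreg⟩
    rwa [show Module.annihilator A (IsLocalRing.ResidueField A) = IsLocalRing.maximalIdeal A from
      Ideal.annihilator_quotient] at hx
  · right
    have := not_subsingleton_iff_nontrivial.mp h
    obtain ⟨f, hf⟩ := exists_ne (0 : IsLocalRing.ResidueField A →ₗ[A] M)
    refine ⟨f 1, fun h0 => hf (residueField_hom_ext h0), fun c hc => ?_⟩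
    rw [← map_smul, smul_residueField_eq_zero hc, map_zero]

lemma subsingleton_ext_self (K : ModuleCat.{u} A) (i : ℕ) :
    Subsingleton (Ext (ModuleCat.of A A) K (i + 1)) :=
  subsingleton_of_forall_eq 0 fun x => Ext.eq_zero_of_projective x

/-- The annihilators of the powers of `x` stabilize, so `x ^ j` and `x ^ (j + 1)` have the same
annihilator for some `j`. Self-injectivity then makes `x ^ j` a multiple of `x ^ (j + 1)`, hence
zero in a local ring. -/
lemma isNilpotent_of_injective_self [IsLocalRing A] [IsNoetherianRing A]
    (h : HasInjectiveDimensionLE (ModuleCat.of A A) 0) {x : A}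
    (hx : x ∈ IsLocalRing.maximalIdeal A) : IsNilpotent x := by
  have hinj : IsInjectiveModulo (0 : A) A := fun N _ _ P _ f =>
    exists_extend_of_subsingleton_ext P
      (HasInjectiveDimensionLT.subsingleton (ModuleCat.of A A) 1 1 le_rfl _) f
  let F : ℕ →o Ideal A :=
    ⟨fun j => LinearMap.ker (LinearMap.mulLeft A (x ^ j)), fun i j hij a ha => by
      obtain ⟨k, rfl⟩ := Nat.exists_eq_add_of_le hij
      have ha' : x ^ i * a = 0 := ha
      change x ^ (i + k) * a = 0
      rw [pow_add, mul_right_comm, ha', zero_mul]⟩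
  obtain ⟨j, hj⟩ := monotone_stabilizes_iff_noetherian.mpr ‹IsNoetherianRing A› F
  obtain ⟨f, hf⟩ := hinj.exists_map (N := A) (by simp) (x ^ (j + 1)) (x ^ j) fun a ha => by
    have h1 : a ∈ F (j + 1) := by
      change x ^ (j + 1) * a = 0
      rw [mul_comm]
      exact ha
    rw [← hj (j + 1) (Nat.le_succ j)] at h1
    have h2 : x ^ j * a = 0 := h1
    rw [smul_eq_mul, mul_comm, h2]
  rw [← mul_one (x ^ (j + 1)), ← smul_eq_mul, map_smul, smul_eq_mul, pow_succ] at hf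
  have hu : IsUnit (1 - x * f 1) := by
    refine (IsLocalRing.isUnit_or_isUnit_one_sub_self (x * f 1)).resolve_left fun h => ?_
    exact (IsLocalRing.mem_maximalIdeal _).mp (Ideal.mul_mem_right _ _ hx) h
  refine ⟨j, ?_⟩
  refine hu.mul_left_eq_zero.mp ?_
  linear_combination -hf

/-- A ring of positive dimension with finite self-injective dimension has positive depth. -/
lemma exists_isSMulRegular_self [IsLocalRing A] [IsNoetherianRing A]
    (hd : ringKrullDim A = 1) (h : ∃ n : ℕ, HasInjectiveDimensionLE (ModuleCat.of A A) n) :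
    ∃ x ∈ IsLocalRing.maximalIdeal A, IsSMulRegular A x := by
  refine (exists_isSMulRegular_or_socle A).resolve_right ?_
  rintro ⟨v, hv, hmv⟩
  -- In depth zero the residue field embeds in the free module `A`, so `A` would be self-injective,
  -- its maximal ideal nil and its dimension zero.
  have h0 := hasInjectiveDimensionLE_of_residueField_embeds A h _
    (residueFieldMap_injective hmv hv) 0 fun i hi => by
      obtain ⟨i, rfl⟩ := Nat.exists_eq_succ_of_ne_zero hi.ne'
      exact subsingleton_ext_self _ i
  have : Ring.KrullDimLE 0 A := Ring.KrullDimLE.mk₀ fun p hp => by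
    have : p = IsLocalRing.maximalIdeal A := by
      refine le_antisymm (IsLocalRing.le_maximalIdeal hp.ne_top) fun x hx => ?_
      obtain ⟨n, hn⟩ := isNilpotent_of_injective_self h0 hx
      exact hp.mem_of_pow_mem n (hn ▸ p.zero_mem)
    exact this ▸ IsLocalRing.maximalIdeal.isMaximal A
  rw [Ring.krullDimLE_iff, hd] at this
  exact absurd this (by norm_num)

/-- The residue field embeds in `A/xA`, whose projective dimension is at most one, so `Ext^i(A/xA,
K)` vanishes for `i > 1`. -/
lemma hasInjectiveDimensionLE_one [IsLocalRing A] [IsNoetherianRing A] (hd : ringKrullDim A = 1)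
    {x : A} (hx : x ∈ IsLocalRing.maximalIdeal A) (hreg : IsSMulRegular A x)
    (K : Type u) [AddCommGroup K] [Module A K] [Module.Finite A K]
    (hK : ∃ n : ℕ, HasInjectiveDimensionLE (ModuleCat.of A K) n) :
    HasInjectiveDimensionLE (ModuleCat.of A K) 1 := by
  obtain ⟨j, hj⟩ := exists_maximalIdeal_pow_le_span hd hx hreg
  have h1 : (1 : A) ∉ Ideal.span {x} := fun h =>
    (IsLocalRing.mem_maximalIdeal _).mp hx
      (isUnit_of_dvd_one (Ideal.mem_span_singleton.mp h))
  obtain ⟨r, hr, hmr⟩ := exists_smul_socle (Ideal.span {x}) h1 fun c hc => by simpa using hj hc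
  simp only [smul_eq_mul, mul_one, Ideal.mem_span_singleton] at hr hmr
  have hsoc : ∀ c ∈ IsLocalRing.maximalIdeal A,
      c • (Submodule.Quotient.mk r : QuotSMulTop x A) = 0 := fun c hc => by
    rw [← Submodule.Quotient.mk_smul, quotSMulTop_mk_self_eq_zero_iff]
    exact hmr c hc
  refine hasInjectiveDimensionLE_of_residueField_embeds K hK _
    (residueFieldMap_injective hsoc (mt quotSMulTop_mk_self_eq_zero_iff.mp hr)) 1 fun i hi => ?_
  obtain ⟨i, rfl⟩ := Nat.exists_eq_add_of_le' hi
  exact subsingleton_ext_right (LinearMap.exact_lsmul_mkQ_smul_top A x) hreg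
    (Submodule.mkQ_surjective _) _ _ (subsingleton_ext_self _ i) (subsingleton_ext_self _ _)

lemma exists_isSMulRegular_of_localDepth_eq_one [IsLocalRing A] {M : Type u} [AddCommGroup M]
    [Module A M] (h : (localDepth A M : WithBot ℕ∞) = 1) :
    ∃ x ∈ IsLocalRing.maximalIdeal A, IsSMulRegular M x := by
  by_contra! hc
  have h0 : localDepth A M = 0 := by
    refine le_antisymm (iSup₂_le fun rs hrs => ?_) bot_le
    match rs, hrs with
    | [], _ => simp
    | r :: rs, ⟨hreg, hmem⟩ =>
      exact absurd ((RingTheory.Sequence.isRegular_cons_iff M r rs).mp hreg).1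
        (hc r (hmem r List.mem_cons_self))
  rw [h0] at h
  exact absurd h (by norm_num)

lemma localDepth_eq_one [IsLocalRing A] [IsNoetherianRing A] (hd : ringKrullDim A = 1)
    {M : Type u} [AddCommGroup M] [Module A M] [Module.Finite A M] [Nontrivial M] {x : A}
    (hx : x ∈ IsLocalRing.maximalIdeal A) (hreg : IsSMulRegular M x) : localDepth A M = 1 := by
  refine le_antisymm (iSup₂_le fun rs hrs => ?_) ?_
  · have h1 := Module.supportDim_add_length_eq_supportDim_of_isRegular rs hrs.1
    have h2 : Module.supportDim A M ≤ 1 := hd ▸ Module.supportDim_le_ringKrullDim A M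
    have := hrs.1.quot_ofList_smul_nontrivial ⊤
    have h3 : 0 ≤ Module.supportDim A (M ⧸ Ideal.ofList rs • (⊤ : Submodule A M)) := by
      have h := Module.supportDim_ne_bot_of_nontrivial A
        (M ⧸ Ideal.ofList rs • (⊤ : Submodule A M))
      generalize Module.supportDim A (M ⧸ Ideal.ofList rs • (⊤ : Submodule A M)) = e at h ⊢
      induction e with
      | bot => exact absurd rfl h
      | coe e => exact_mod_cast (zero_le : 0 ≤ e)
    have h4 : (rs.length : WithBot ℕ∞) ≤ 1 := by
      calc (rs.length : WithBot ℕ∞) = 0 + rs.length := (zero_add _).symm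
        _ ≤ _ := by gcongr
        _ ≤ 1 := h1 ▸ h2
    exact_mod_cast h4
  · refine le_trans ?_ (le_iSup₂ (f := fun (rs : List A) (_ : RingTheory.Sequence.IsRegular M rs ∧
      ∀ r ∈ rs, r ∈ IsLocalRing.maximalIdeal A) => (rs.length : ℕ∞)) [x] ⟨?_, by simpa using hx⟩)
    · simp
    · exact RingTheory.Sequence.IsRegular.of_isWeaklyRegular_of_mem_maximalIdeal M
        (fun r hr => List.mem_singleton.mp hr ▸ hx)
        ((RingTheory.Sequence.isWeaklyRegular_singleton_iff M x).mpr hreg)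

/-- With `exists_maximalIdeal_pow_le_span`, this lets one regular element serve several modules: if
some element of the maximal ideal is regular on `M`, so is every `x` that generates an ideal
containing a power of the maximal ideal. -/
lemma isSMulRegular_of_pow_mem_span {M : Type*} [AddCommGroup M] [Module A M] {x y : A} {j : ℕ}
    (hy : IsSMulRegular M y) (h : y ^ j ∈ Ideal.span {x}) : IsSMulRegular M x := by
  obtain ⟨a, ha⟩ := Ideal.mem_span_singleton'.mp h
  intro u v huv
  apply hy.pow j
  change y ^ j • u = y ^ j • v
  rw [← ha, mul_smul, mul_smul]
  exact congr(a • $huv)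

end DimensionOne

/-! ### Homomorphisms from `I` to `R`, and reduction of `I` and its annihilator modulo `x`. -/

section GorensteinDimensionOne

variable {R : Type u} [CommRing R]

/-- If `R/I` has depth one, every homomorphism from `I` to a one-dimensional Gorenstein ring `R` is
a multiplication. -/
lemma exists_eq_mul_of_hom [IsLocalRing R] [IsNoetherianRing R]
    (hR : HasInjectiveDimensionLE (ModuleCat.of R R) 1) {I : Ideal R} {x : R}
    (hx : x ∈ IsLocalRing.maximalIdeal R) (hxI : IsSMulRegular (R ⧸ I) x) (f : I →ₗ[R] R) :
    ∃ r : R, ∀ i : I, f i = r * i := by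
  obtain ⟨g, hg⟩ := exists_extend_of_subsingleton_ext I
    (subsingleton_ext_of_isSMulRegular hx hxI 1
      (HasInjectiveDimensionLT.subsingleton (ModuleCat.of R R) 2 2 le_rfl _)) f
  refine ⟨g 1, fun i => ?_⟩
  rw [← hg i, mul_comm, ← smul_eq_mul, ← map_smul, smul_eq_mul, mul_one]

lemma dvd_of_mem_of_isSMulRegular_quotient {I : Ideal R} {x : R} (hxI : IsSMulRegular (R ⧸ I) x)
    {r : R} (h : x * r ∈ I) : r ∈ I := by
  rw [← Submodule.Quotient.mk_eq_zero]
  apply hxI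
  change x • (Submodule.Quotient.mk r : R ⧸ I) = x • (0 : R ⧸ I)
  rw [← Submodule.Quotient.mk_smul, smul_zero, smul_eq_mul, Submodule.Quotient.mk_eq_zero]
  exact h

/-- The annihilator of `I` modulo `x` is the image of the annihilator of `I`. -/
lemma exists_dvd_sub_of_forall_dvd [IsLocalRing R] [IsNoetherianRing R]
    (hR : HasInjectiveDimensionLE (ModuleCat.of R R) 1) {I : Ideal R} {x : R}
    (hx : x ∈ IsLocalRing.maximalIdeal R) (hreg : IsSMulRegular R x)
    (hxI : IsSMulRegular (R ⧸ I) x) {c : R} (hc : ∀ i ∈ I, x ∣ c * i) :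
    ∃ d, (∀ i ∈ I, d * i = 0) ∧ x ∣ c - d := by
  -- `f` is division by `x` of multiplication by `c` on `I`. Being linear it is multiplication by
  -- some `r`, so `c - x * r` annihilates `I`.
  choose f hf using fun i : I => hc i i.2
  have hinj : ∀ {a b : R}, x * a = x * b → a = b := fun h => hreg h
  let F : I →ₗ[R] R :=
    { toFun := f
      map_add' := fun a b => hinj (by
        rw [mul_add, ← hf, ← hf, ← hf, ← mul_add]
        rfl)
      map_smul' := fun a b => hinj (by
        have h := hf b
        rw [← hf, RingHom.id_apply, smul_eq_mul]
        change c * (a * b) = _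
        linear_combination a * h) }
  obtain ⟨r, hr⟩ := exists_eq_mul_of_hom hR hx hxI F
  refine ⟨c - x * r, fun i hi => ?_, ⟨r, by ring⟩⟩
  have h1 := hf ⟨i, hi⟩
  have h2 : f ⟨i, hi⟩ = r * i := hr ⟨i, hi⟩
  rw [h2] at h1
  linear_combination h1

/-- A nonzero ideal meets the socle of `R` modulo `x`. -/
lemma exists_socle_mem [IsLocalRing R] [IsNoetherianRing R] {I : Ideal R} (hI : I ≠ ⊥) {x : R}
    (hx : x ∈ IsLocalRing.maximalIdeal R) (hxI : IsSMulRegular (R ⧸ I) x) {j : ℕ}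
    (hj : IsLocalRing.maximalIdeal R ^ j ≤ Ideal.span {x}) :
    ∃ s ∈ I, ¬ x ∣ s ∧ ∀ c ∈ IsLocalRing.maximalIdeal R, x ∣ c * s := by
  -- If `I ⊆ xR`, then `I = xI` by regularity on `R/I`, and Nakayama gives `I = 0`.
  obtain ⟨i, hi, hxi⟩ : ∃ i ∈ I, ¬ x ∣ i := by
    by_contra! hc
    refine hI (Submodule.eq_bot_of_le_smul_of_le_jacobson_bot (Ideal.span {x}) I
      (IsNoetherian.noetherian I) (fun i hi => ?_) ?_)
    · obtain ⟨r, rfl⟩ := hc i hi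
      exact Submodule.smul_mem_smul (Ideal.mem_span_singleton_self x)
        (dvd_of_mem_of_isSMulRegular_quotient hxI hi)
    · rw [IsLocalRing.jacobson_eq_maximalIdeal _ bot_ne_top, Ideal.span_singleton_le_iff_mem]
      exact hx
  obtain ⟨r, hr, hmr⟩ := exists_smul_socle (Ideal.span {x})
    (mt Ideal.mem_span_singleton.mp hxi) fun c hc => Ideal.mul_mem_right i _ (hj hc)
  exact ⟨r * i, I.mul_mem_left r hi, mt Ideal.mem_span_singleton.mpr hr, fun c hc =>
    Ideal.mem_span_singleton.mp (hmr c hc)⟩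

end GorensteinDimensionOne

/-! ### Basic properties of the idealization. -/

section Idealization

variable {R : Type u} [CommRing R] {I : Ideal R}

lemma idealization_fst_mul (a b : TrivSqZeroExt R I) : (a * b).fst = a.fst * b.fst := rfl

lemma idealization_snd_mul (a b : TrivSqZeroExt R I) :
    ((a * b).snd : R) = a.fst * b.snd + b.fst * a.snd := by
  simp [TrivSqZeroExt.snd_mul]

lemma idealization_ext {a b : TrivSqZeroExt R I} (h₁ : a.fst = b.fst)
    (h₂ : (a.snd : R) = b.snd) : a = b :=
  TrivSqZeroExt.ext h₁ (Subtype.ext h₂)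

instance idealization_isLocalRing [IsLocalRing R] : IsLocalRing (TrivSqZeroExt R I) :=
  IsLocalRing.of_isUnit_or_isUnit_one_sub_self fun a => by
    rw [TrivSqZeroExt.isUnit_iff_isUnit_fst, TrivSqZeroExt.isUnit_iff_isUnit_fst]
    exact IsLocalRing.isUnit_or_isUnit_one_sub_self a.fst

lemma idealization_mem_maximalIdeal [IsLocalRing R] {a : TrivSqZeroExt R I} :
    a ∈ IsLocalRing.maximalIdeal (TrivSqZeroExt R I) ↔ a.fst ∈ IsLocalRing.maximalIdeal R := by
  rw [IsLocalRing.mem_maximalIdeal, IsLocalRing.mem_maximalIdeal, mem_nonunits_iff,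
    mem_nonunits_iff, TrivSqZeroExt.isUnit_iff_isUnit_fst]

instance idealization_isNoetherianRing [IsNoetherianRing R] :
    IsNoetherianRing (TrivSqZeroExt R I) :=
  @IsNoetherianRing.of_finite R (TrivSqZeroExt R I) _ _ Algebra.toModule IsScalarTower.right _
    (inferInstanceAs (Module.Finite R (R × I)))

lemma ringKrullDim_idealization : ringKrullDim (TrivSqZeroExt R I) = ringKrullDim R := by
  let f : TrivSqZeroExt R I →+* R := (TrivSqZeroExt.fstHom R R I).toRingHom
  have hf : Function.Surjective f := fun r => ⟨TrivSqZeroExt.inl r, rfl⟩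
  have hker : RingHom.ker f ≤ nilradical (TrivSqZeroExt R I) := fun a ha => by
    rw [mem_nilradical, TrivSqZeroExt.isNilpotent_iff_isNilpotent_fst]
    rw [show a.fst = 0 from ha]
    exact IsNilpotent.zero
  rw [← ringKrullDim_eq_of_ringEquiv (R := TrivSqZeroExt R I ⧸ RingHom.ker f) (S := R) (RingHom.quotientKerEquivOfSurjective hf),
    ringKrullDim_quotient, (PrimeSpectrum.zeroLocus_eq_univ_iff _).mpr hker]
  exact (Order.krullDim_eq_of_orderIso OrderIso.Set.univ).symm

lemma isSMulRegular_inl {x : R} (hreg : IsSMulRegular R x) :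
    IsSMulRegular (TrivSqZeroExt R I) (TrivSqZeroExt.inl x : TrivSqZeroExt R I) := by
  intro a b hab
  have hinj : ∀ {a b : R}, x * a = x * b → a = b := fun h => hreg h
  have h : TrivSqZeroExt.inl x * a = TrivSqZeroExt.inl x * b := hab
  refine idealization_ext (hinj congr(($h).fst)) (hinj ?_)
  have := congr((($h).snd : R))
  rw [idealization_snd_mul, idealization_snd_mul] at this
  simpa using this

/-- Regularity of `x` on `R/I` gives `I ∩ xR = xI`. Hence divisibility in the second coordinate may
be tested in `R`. -/
lemma inl_dvd_iff {x : R} (hxI : IsSMulRegular (R ⧸ I) x) {a : TrivSqZeroExt R I} :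
    (TrivSqZeroExt.inl x : TrivSqZeroExt R I) ∣ a ↔ x ∣ a.fst ∧ x ∣ (a.snd : R) := by
  constructor
  · rintro ⟨b, rfl⟩
    exact ⟨⟨b.fst, rfl⟩, ⟨b.snd, by rw [idealization_snd_mul]; simp⟩⟩
  · rintro ⟨⟨b, hb⟩, ⟨c, hc⟩⟩
    have hcI : c ∈ I := dvd_of_mem_of_isSMulRegular_quotient hxI (hc ▸ a.snd.2)
    refine ⟨TrivSqZeroExt.inl b + TrivSqZeroExt.inr ⟨c, hcI⟩, idealization_ext ?_ ?_⟩
    · simp [hb]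
    · simp [hc]

end Idealization

/-! ### Multiplicity in dimension zero versus being killed by the maximal ideal. -/

section Multiplicity

variable {A : Type u} [CommRing A] [IsLocalRing A]

lemma length_quotient_maximalIdeal_smul_top (C : Type u) [AddCommGroup C] [Module A C]
    [Module.Finite A C] :
    Module.length A (C ⧸ (IsLocalRing.maximalIdeal A • (⊤ : Submodule A C))) =
      ((⊤ : Submodule A C).spanFinrank : ℕ∞) := by
  rw [IsLocalRing.spanFinrank_eq_finrank_quotient _ Module.Finite.fg_top]
  let := Ideal.Quotient.field (IsLocalRing.maximalIdeal A)
  rw [← Module.length_eq_finrank, ← Module.length_eq_of_surjective (S := A)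
    (R := A ⧸ IsLocalRing.maximalIdeal A) Ideal.Quotient.mk_surjective]
  refine LinearEquiv.length_eq (Submodule.Quotient.equiv _ _ Submodule.topEquiv ?_).symm
  rw [Submodule.map_smul'']
  congr 1
  exact (Submodule.map_top _).trans (LinearEquiv.range _)

lemma hasMultiplicity_zero_of_maximalIdeal_smul_eq_bot (C : Type u) [AddCommGroup C] [Module A C]
    [Module.Finite A C] (h : IsLocalRing.maximalIdeal A • (⊤ : Submodule A C) = ⊥) :
    HasMultiplicity A C 0 ((⊤ : Submodule A C).spanFinrank : ℝ) := by
  have hl := length_quotient_maximalIdeal_smul_top (A := A) C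
  have hpow (n : ℕ) : IsLocalRing.maximalIdeal A ^ (n + 1) • (⊤ : Submodule A C) =
      IsLocalRing.maximalIdeal A • (⊤ : Submodule A C) := by
    rw [h, pow_succ, Submodule.mul_smul, h, Submodule.smul_bot]
  refine tendsto_const_nhds.congr fun n => ?_
  rw [hpow, hl]
  simp

/-- A convergent sequence of integers is eventually equal to its limit, so `C/𝔪^{n+1}C` and `C/𝔪C`
have the same length for some `n ≥ 1`. Thus `𝔪C = 𝔪^{n+1}C ⊆ 𝔪(𝔪C)`, and Nakayama gives `𝔪C = 0`. -/
lemma maximalIdeal_smul_eq_bot_of_hasMultiplicity_zero [IsNoetherianRing A] (C : Type u)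
    [AddCommGroup C] [Module A C] [Module.Finite A C] [Nontrivial C]
    (h : HasMultiplicity A C 0 ((⊤ : Submodule A C).spanFinrank : ℝ)) :
    IsLocalRing.maximalIdeal A • (⊤ : Submodule A C) = ⊥ := by
  set 𝔪 := IsLocalRing.maximalIdeal A
  have hl := length_quotient_maximalIdeal_smul_top (A := A) C
  have hpos : (⊤ : Submodule A C).spanFinrank ≠ 0 := fun h0 =>
    bot_ne_top ((Submodule.spanFinrank_eq_zero_iff_eq_bot Module.Finite.fg_top).mp h0).symm
  generalize (⊤ : Submodule A C).spanFinrank = e at h hl hpos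
  simp only [HasMultiplicity, Nat.factorial_zero, Nat.cast_one, pow_zero, div_one, one_mul] at h
  have h' := Nat.isUniformEmbedding_coe_real.isEmbedding.tendsto_nhds_iff.mpr h
  rw [nhds_discrete, tendsto_pure] at h'
  -- The bound `1 ≤ n` makes the exponent `n + 1` at least `2`, as Nakayama needs below.
  obtain ⟨n, hn, hn1⟩ := (h'.and (eventually_ge_atTop 1)).exists
  have hlen : Module.length A (C ⧸ (𝔪 ^ (n + 1) • (⊤ : Submodule A C))) = e := by
    rw [← hn, ENat.natCast_toNat]
    intro htop
    rw [htop] at hn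
    exact hpos hn.symm
  have hle : 𝔪 ^ (n + 1) • (⊤ : Submodule A C) ≤ 𝔪 • ⊤ :=
    Submodule.smul_mono_left (Ideal.pow_le_self (by lia))
  let f := Submodule.factor hle
  have hadd := Module.length_eq_add_of_exact (LinearMap.ker f).subtype f
    (Submodule.subtype_injective _) (Submodule.factor_surjective hle)
    (LinearMap.exact_subtype_ker_map f)
  rw [hlen, hl] at hadd
  have hker : Module.length A (LinearMap.ker f) = 0 := by
    generalize Module.length A (LinearMap.ker f) = l at hadd
    induction l with
    | top => simp at hadd
    | coe l =>
      norm_cast at hadd ⊢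
      lia
  rw [Module.length_eq_zero_iff, Submodule.subsingleton_iff_eq_bot] at hker
  have hle' : 𝔪 • (⊤ : Submodule A C) ≤ 𝔪 • (𝔪 • ⊤) := by
    refine le_trans (fun c hc => ?_ : _ ≤ 𝔪 ^ (n + 1) • (⊤ : Submodule A C)) ?_
    · have h1 : (Submodule.Quotient.mk c : C ⧸ (𝔪 ^ (n + 1) • (⊤ : Submodule A C))) ∈
          LinearMap.ker f := by
        rw [LinearMap.mem_ker]
        exact (Submodule.Quotient.mk_eq_zero _).mpr hc
      rwa [hker, Submodule.mem_bot, Submodule.Quotient.mk_eq_zero] at h1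
    · rw [← Submodule.mul_smul, ← pow_two]
      exact Submodule.smul_mono_left (Ideal.pow_le_pow_right (by lia))
  exact Submodule.eq_bot_of_le_smul_of_le_jacobson_bot 𝔪 _ (IsNoetherian.noetherian _) hle'
    (IsLocalRing.jacobson_eq_maximalIdeal _ bot_ne_top).ge

end Multiplicity

/-! ### Socle comparison in the idealization modulo `x`. -/

section Forward

variable {R : Type u} [CommRing R] {I : Ideal R}

/-- The pair `(u, w)` as an element of the idealization. -/
def idealizationMk (u : R) (w : R) (hw : w ∈ I) : TrivSqZeroExt R I :=
  TrivSqZeroExt.inl u + TrivSqZeroExt.inr ⟨w, hw⟩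

@[simp] lemma idealizationMk_fst (u w : R) (hw : w ∈ I) : (idealizationMk u w hw).fst = u := by
  simp [idealizationMk]

@[simp] lemma idealizationMk_snd (u w : R) (hw : w ∈ I) :
    ((idealizationMk u w hw).snd : R) = w := by
  simp [idealizationMk]

/-- Elements of the idealization annihilated by the maximal ideal modulo `x`. -/
lemma inl_dvd_mul_of_socle [IsLocalRing R] {x : R} (hxI : IsSMulRegular (R ⧸ I) x)
    (hIm : I ≤ IsLocalRing.maximalIdeal R) {a : TrivSqZeroExt R I}
    (h₁ : ∀ c ∈ IsLocalRing.maximalIdeal R, x ∣ c * a.fst)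
    (h₂ : ∀ c ∈ IsLocalRing.maximalIdeal R, x ∣ c * (a.snd : R)) :
    ∀ c ∈ IsLocalRing.maximalIdeal (TrivSqZeroExt R I), (TrivSqZeroExt.inl x) ∣ c * a := by
  intro c hc
  rw [idealization_mem_maximalIdeal] at hc
  rw [inl_dvd_iff hxI, idealization_fst_mul, idealization_snd_mul]
  exact ⟨h₁ _ hc, dvd_add (h₂ _ hc) (mul_comm a.fst (c.snd : R) ▸ h₁ _ (hIm c.snd.2))⟩

lemma socle_of_inl_dvd_mul [IsLocalRing R] {x : R} (hxI : IsSMulRegular (R ⧸ I) x)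
    {a : TrivSqZeroExt R I}
    (h : ∀ c ∈ IsLocalRing.maximalIdeal (TrivSqZeroExt R I), (TrivSqZeroExt.inl x) ∣ c * a) :
    (∀ c ∈ IsLocalRing.maximalIdeal R, x ∣ c * a.fst) ∧
      ∀ c ∈ IsLocalRing.maximalIdeal R, x ∣ c * (a.snd : R) := by
  have key : ∀ c ∈ IsLocalRing.maximalIdeal R, x ∣ c * a.fst ∧ x ∣ c * (a.snd : R) :=
    fun c hc => by
      have h1 := h (TrivSqZeroExt.inl c) (idealization_mem_maximalIdeal.mpr hc)
      rw [inl_dvd_iff hxI, idealization_fst_mul, idealization_snd_mul] at h1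
      simpa using h1
  exact ⟨fun c hc => (key c hc).1, fun c hc => (key c hc).2⟩

/-- Let `𝔟` be an ideal of the idealization containing `x` whose image modulo `x` is killed by the
maximal ideal and such that the quotient by `𝔟` has simple socle. Then the elements of `I` that
annihilate `I` modulo `x` lie in the socle modulo `x`. -/
lemma dvd_mul_of_simple_socle [IsLocalRing R] {x s : R} (hxI : IsSMulRegular (R ⧸ I) x)
    (hIm : I ≤ IsLocalRing.maximalIdeal R) {j : ℕ}
    (hj : IsLocalRing.maximalIdeal R ^ j ≤ Ideal.span {x}) (hsI : s ∈ I)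
    (hms : ∀ c ∈ IsLocalRing.maximalIdeal R, x ∣ c * s)
    (hsoc : ∀ t, (∀ c ∈ IsLocalRing.maximalIdeal R, x ∣ c * t) → ∃ r, x ∣ t - r * s)
    (𝔟 : Ideal (TrivSqZeroExt R I)) (hx𝔟 : TrivSqZeroExt.inl x ∈ 𝔟)
    (h𝔟 : ∀ a ∈ 𝔟, ∀ c ∈ IsLocalRing.maximalIdeal (TrivSqZeroExt R I),
      TrivSqZeroExt.inl x ∣ c * a)
    (hsimple : ∀ a₁ a₂ : TrivSqZeroExt R I,
      (∀ c ∈ IsLocalRing.maximalIdeal (TrivSqZeroExt R I), c * a₁ ∈ 𝔟) →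
      (∀ c ∈ IsLocalRing.maximalIdeal (TrivSqZeroExt R I), c * a₂ ∈ 𝔟) →
      a₁ ∉ 𝔟 → ∃ e, a₂ - e * a₁ ∈ 𝔟)
    {a : R} (haI : a ∈ I) (ha : ∀ i ∈ I, x ∣ a * i) :
    ∀ c ∈ IsLocalRing.maximalIdeal R, x ∣ c * a := by
  -- `U` is the preimage in `R` of the socle of `R/xR`.
  let U : Ideal R := Ideal.span {x} ⊔ Ideal.span {s}
  have hU : ∀ t, t ∈ U ↔ ∃ r, x ∣ t - r * s := fun t => by
    change t ∈ Ideal.span {x} ⊔ Ideal.span {s} ↔ _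
    rw [sup_comm, Ideal.mem_span_singleton_sup]
    constructor
    · rintro ⟨r, b, hb, rfl⟩
      exact ⟨r, by simpa using Ideal.mem_span_singleton.mp hb⟩
    · rintro ⟨r, hr⟩
      exact ⟨r, t - r * s, Ideal.mem_span_singleton.mpr hr, by ring⟩
  have hU' : ∀ t, (∀ c ∈ IsLocalRing.maximalIdeal R, x ∣ c * t) ↔ t ∈ U := fun t => by
    rw [hU]
    refine ⟨hsoc t, ?_⟩
    rintro ⟨r, hr⟩ c hc
    have : c * t = c * (t - r * s) + r * (c * s) := by ring
    exact this ▸ dvd_add (hr.mul_left c) ((hms c hc).mul_left r)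
  rw [hU']
  by_contra haU
  -- A multiple `b` of `a` lies outside `U` with `𝔪b ⊆ U`. Below, the `v α β` span the
  -- two-dimensional socle of `A/xA` modulo `x`, and the `w α β` are the analogous pairs built from
  -- `b`.
  obtain ⟨r, hrU, hmr⟩ := exists_smul_socle U haU fun c hc =>
    le_sup_left (a := Ideal.span {x}) (Ideal.mul_mem_right a _ (hj hc))
  generalize hba : r • a = b at hrU hmr
  have hbI : b ∈ I := hba ▸ I.mul_mem_left r haI
  have hb : ∀ i ∈ I, x ∣ b * i := fun i hi => by
    rw [← hba, smul_eq_mul, mul_assoc]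
    exact (ha i hi).mul_left r
  have hdvd : ∀ {u : TrivSqZeroExt R I}, TrivSqZeroExt.inl x ∣ u → u ∈ 𝔟 := fun h =>
    𝔟.mem_of_dvd h hx𝔟
  have hmem : ∀ {u v : TrivSqZeroExt R I}, x ∣ u.fst - v.fst → x ∣ (u.snd : R) - v.snd →
      v ∈ 𝔟 → u ∈ 𝔟 := fun {u v} h1 h2 hv => by
    rw [← sub_add_cancel u v]
    exact 𝔟.add_mem (hdvd ((inl_dvd_iff hxI).mpr ⟨by simpa using h1, by simpa using h2⟩)) hv
  let v (α β : R) : TrivSqZeroExt R I := idealizationMk (α * s) (β * s) (I.mul_mem_left β hsI)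
  have hsU : ∀ α, α * s ∈ U := fun α => (hU _).mpr ⟨α, by simp⟩
  have hv : ∀ α β, ∀ c ∈ IsLocalRing.maximalIdeal (TrivSqZeroExt R I),
      TrivSqZeroExt.inl x ∣ c * v α β := fun α β =>
    inl_dvd_mul_of_socle hxI hIm (by simpa [v] using (hU' _).mpr (hsU α))
      (by simpa [v] using (hU' _).mpr (hsU β))
  have h𝔟U : ∀ u ∈ 𝔟, u.fst ∈ U ∧ (u.snd : R) ∈ U := fun u hu => by
    rw [← hU', ← hU']
    exact socle_of_inl_dvd_mul hxI (h𝔟 u hu)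
  let w (α β : R) : TrivSqZeroExt R I := idealizationMk (α * b) (β * b) (I.mul_mem_left β hbI)
  have hw : ∀ α β, (∀ q, v (q * α) (q * β) ∈ 𝔟) →
      ∀ c ∈ IsLocalRing.maximalIdeal (TrivSqZeroExt R I), c * w α β ∈ 𝔟 := by
    intro α β hvq c hc
    obtain ⟨q, hq⟩ := (hU _).mp (hmr c.fst (idealization_mem_maximalIdeal.mp hc))
    obtain ⟨p, hp⟩ := hb c.snd c.snd.2
    obtain ⟨y, hy⟩ := hq
    rw [smul_eq_mul] at hy
    refine hmem ?_ ?_ (hvq q)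
    · rw [idealization_fst_mul]
      simp only [v, w, idealizationMk_fst]
      exact ⟨α * y, by linear_combination α * hy⟩
    · rw [idealization_snd_mul]
      simp only [v, w, idealizationMk_fst, idealizationMk_snd]
      exact ⟨β * y + α * p, by linear_combination β * hy + α * hp⟩
  -- If `𝔟` contains that whole socle, `w 1 0` and `w 0 1` both lie in the simple socle of `A/𝔟`.
  -- Comparing second coordinates, where `bI ⊆ xR` removes the cross term, puts `b` in `U`.
  by_cases hall : ∀ α β, v α β ∈ 𝔟
  · obtain ⟨e, he⟩ := hsimple (w 1 0) (w 0 1) (hw 1 0 fun q => hall _ _)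
      (hw 0 1 fun q => hall _ _) fun h => hrU (by simpa [w] using (h𝔟U _ h).1)
    have h2 := (h𝔟U _ he).2
    rw [TrivSqZeroExt.snd_sub, Submodule.coe_sub, idealization_snd_mul] at h2
    simp only [w, idealizationMk_fst, idealizationMk_snd] at h2
    refine hrU ?_
    obtain ⟨q, y, hy⟩ := (hU _).mp h2
    obtain ⟨p, hp⟩ := hb e.snd e.snd.2
    exact (hU _).mpr ⟨q, y + p, by linear_combination hy + hp⟩
  · push Not at hall
    obtain ⟨α₀, β₀, h₀⟩ := hall
    -- Otherwise the image of the socle of `A/xA` in `A/𝔟` has dimension at most one, so `𝔟`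
    -- contains a pair `v α β` with a coordinate equal to `1`.
    obtain ⟨α, β, hαβ, hor⟩ : ∃ α β, v α β ∈ 𝔟 ∧ (α = 1 ∨ β = 1) := by
      by_cases h10 : v 1 0 ∈ 𝔟
      · exact ⟨1, 0, h10, Or.inl rfl⟩
      · obtain ⟨e, he⟩ := hsimple (v 1 0) (v 0 1) (fun c hc => hdvd (hv _ _ c hc))
          (fun c hc => hdvd (hv _ _ c hc)) h10
        refine ⟨-e.fst, 1, hmem ?_ ?_ he, Or.inr rfl⟩
        · rw [TrivSqZeroExt.fst_sub, idealization_fst_mul]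
          simp [v]
        · rw [TrivSqZeroExt.snd_sub, Submodule.coe_sub, idealization_snd_mul]
          simp only [v, idealizationMk_fst, idealizationMk_snd]
          obtain ⟨p, hp⟩ := hms e.snd (hIm e.snd.2)
          exact ⟨p, by linear_combination hp⟩
    have hq : ∀ q, v (q * α) (q * β) ∈ 𝔟 := fun q => by
      refine hmem ?_ ?_ (𝔟.mul_mem_left (TrivSqZeroExt.inl q) hαβ)
      · rw [idealization_fst_mul]
        simp [v, mul_assoc]
      · rw [idealization_snd_mul]
        simp [v, mul_assoc]
    -- Now `w α β` is in the socle of `A/𝔟`, which `v α₀ β₀` generates. So `w α β` is killed by the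
    -- maximal ideal modulo `x`, and its coordinate `b` lies in `U`.
    obtain ⟨e, he⟩ := hsimple (v α₀ β₀) (w α β) (fun c hc => hdvd (hv _ _ c hc)) (hw α β hq) h₀
    have hwU := socle_of_inl_dvd_mul hxI (a := w α β) fun c hc => by
      have h1 := h𝔟 _ he c hc
      rw [mul_sub, mul_left_comm] at h1
      exact (dvd_sub_left ((hv α₀ β₀ c hc).mul_left e)).mp h1
    rw [hU', hU'] at hwU
    rcases hor with rfl | rfl
    · exact hrU (by simpa [w] using hwU.1)
    · exact hrU (by simpa [w] using hwU.2)

end Forward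

/-! ### From an almost Gorenstein embedding to `I + J = 𝔪`. -/

section Forward

variable {R : Type u} [CommRing R] {I : Ideal R}

/-- If the cokernel of an embedding of the idealization into its canonical module is killed by the
maximal ideal, then modulo a regular element the maximal ideal is the sum of `I` and its
annihilator. -/
lemma exists_dvd_sub_add_of_canonical [IsLocalRing R] [IsNoetherianRing R]
    (hd : ringKrullDim R = 1) (hR : HasInjectiveDimensionLE (ModuleCat.of R R) 1) (hI : I ≠ ⊥)
    (hIm : I ≤ IsLocalRing.maximalIdeal R) {x : R} (hx : x ∈ IsLocalRing.maximalIdeal R)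
    (hreg : IsSMulRegular R x) (hxI : IsSMulRegular (R ⧸ I) x)
    {K : Type u} [AddCommGroup K] [Module (TrivSqZeroExt R I) K]
    (hK : HasInjectiveDimensionLE (ModuleCat.of (TrivSqZeroExt R I) K) 1)
    (e : Ext (ModuleCat.of (TrivSqZeroExt R I) (IsLocalRing.ResidueField (TrivSqZeroExt R I)))
      (ModuleCat.of (TrivSqZeroExt R I) K) 1
      ≃ₗ[TrivSqZeroExt R I] IsLocalRing.ResidueField (TrivSqZeroExt R I))
    (hxK : IsSMulRegular K (TrivSqZeroExt.inl x : TrivSqZeroExt R I)) (ξ : K)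
    (hξ : ∀ c ∈ IsLocalRing.maximalIdeal (TrivSqZeroExt R I), ∀ κ : K, ∃ a : TrivSqZeroExt R I,
      c • κ = a • ξ) {c : R} (hc : c ∈ IsLocalRing.maximalIdeal R) :
    ∃ i ∈ I, ∃ d, (∀ i ∈ I, d * i = 0) ∧ x ∣ c - (i + d) := by
  have hX : (TrivSqZeroExt.inl x : TrivSqZeroExt R I) ∈ IsLocalRing.maximalIdeal _ :=
    idealization_mem_maximalIdeal.mpr hx
  have hKinj := isInjectiveModulo_quotSMulTop hxK hK
  have hRinj := isInjectiveModulo_quotSMulTop hreg hR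
  obtain ⟨j, hj⟩ := exists_maximalIdeal_pow_le_span hd hx hreg
  obtain ⟨s, hsI, hxs, hms⟩ := exists_socle_mem hI hx hxI hj
  have hsoc : ∀ t, (∀ c ∈ IsLocalRing.maximalIdeal R, x ∣ c * t) → ∃ r, x ∣ t - r * s :=
    fun t ht => hRinj.exists_dvd_sub fun c hcs => by
      by_cases hm : c ∈ IsLocalRing.maximalIdeal R
      · exact ht c hm
      · have hu : IsUnit c := by simpa using hm
        exact absurd ((IsUnit.dvd_mul_left hu).mp hcs) hxs
  obtain ⟨σ, hσ, hmσ⟩ : ∃ σ : QuotSMulTop (TrivSqZeroExt.inl x : TrivSqZeroExt R I) K, σ ≠ 0 ∧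
      ∀ c ∈ IsLocalRing.maximalIdeal (TrivSqZeroExt R I), c • σ = 0 := by
    let E := (homQuotSMulTopEquivExt hxK (smul_residueField_eq_zero hX)).trans e
    refine ⟨E.symm 1 1, fun h => ?_, fun c hc => ?_⟩
    · have h1 : E.symm 1 = 0 := residueField_hom_ext h
      rw [LinearEquiv.map_eq_zero_iff] at h1
      exact one_ne_zero h1
    · rw [← map_smul, smul_residueField_eq_zero hc, map_zero]
  -- `K/xK` is faithful over `A/xA`: a map `A/xA → K/xK` nonzero at `a` sends `a` to `a` times the
  -- image of `1`.
  have hfaith : ∀ a : TrivSqZeroExt R I,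
      (∀ κ : K, ∃ κ' : K, (TrivSqZeroExt.inl x : TrivSqZeroExt R I) • κ' = a • κ) →
        TrivSqZeroExt.inl x ∣ a := by
    intro a ha
    by_contra hxa
    obtain ⟨f, hf⟩ := hKinj.exists_map_ne_zero hσ hmσ smul_quotSMulTop_eq_zero
      (N := QuotSMulTop (TrivSqZeroExt.inl x : TrivSqZeroExt R I) (TrivSqZeroExt R I))
      (v := Submodule.Quotient.mk a) (mt quotSMulTop_mk_self_eq_zero_iff.mp hxa)
    obtain ⟨κ, hκ⟩ := Submodule.Quotient.mk_surjective _ (f (Submodule.Quotient.mk 1))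
    refine hf ?_
    have h1 : (Submodule.Quotient.mk a : QuotSMulTop (TrivSqZeroExt.inl x : TrivSqZeroExt R I)
        (TrivSqZeroExt R I)) = a • Submodule.Quotient.mk 1 := by
      rw [← Submodule.Quotient.mk_smul, smul_eq_mul, mul_one]
    rw [h1, map_smul, ← hκ, ← Submodule.Quotient.mk_smul, quotSMulTop_mk_eq_zero_iff]
    exact ha κ
  let 𝔟 : Ideal (TrivSqZeroExt R I) := LinearMap.ker (LinearMap.toSpanSingleton (TrivSqZeroExt R I)
    (QuotSMulTop (TrivSqZeroExt.inl x : TrivSqZeroExt R I) K) (Submodule.Quotient.mk ξ))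
  have h𝔟 : ∀ a, a ∈ 𝔟 ↔ (Submodule.Quotient.mk (a • ξ) :
      QuotSMulTop (TrivSqZeroExt.inl x : TrivSqZeroExt R I) K) = 0 := fun a => Iff.rfl
  have hker : ∀ a ∈ 𝔟, ∀ c ∈ IsLocalRing.maximalIdeal (TrivSqZeroExt R I),
      TrivSqZeroExt.inl x ∣ c * a := by
    intro a ha c hc
    rw [h𝔟, quotSMulTop_mk_eq_zero_iff] at ha
    obtain ⟨κ', hκ'⟩ := ha
    refine hfaith _ fun κ => ?_
    obtain ⟨a', ha'⟩ := hξ c hc κ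
    -- From `a ξ = x κ'` and `c κ = a' ξ` follows `c a κ = x (a' κ')`.
    exact ⟨a' • κ', by rw [smul_comm, hκ', smul_comm, ← ha', ← mul_smul, mul_comm]⟩
  have hsimple : ∀ a₁ a₂ : TrivSqZeroExt R I,
      (∀ c ∈ IsLocalRing.maximalIdeal (TrivSqZeroExt R I), c * a₁ ∈ 𝔟) →
      (∀ c ∈ IsLocalRing.maximalIdeal (TrivSqZeroExt R I), c * a₂ ∈ 𝔟) →
      a₁ ∉ 𝔟 → ∃ e, a₂ - e * a₁ ∈ 𝔟 := by
    intro a₁ a₂ h₁ h₂ h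
    have hk : ∀ a : TrivSqZeroExt R I,
        (∀ c ∈ IsLocalRing.maximalIdeal (TrivSqZeroExt R I), c * a ∈ 𝔟) →
          ∀ c ∈ IsLocalRing.maximalIdeal (TrivSqZeroExt R I), c • (Submodule.Quotient.mk (a • ξ) :
            QuotSMulTop (TrivSqZeroExt.inl x : TrivSqZeroExt R I) K) = 0 := fun a ha c hc => by
      rw [← Submodule.Quotient.mk_smul, ← mul_smul]
      exact (h𝔟 _).mp (ha c hc)
    obtain ⟨r, hr⟩ := exists_smul_eq_of_ext_equiv hX hxK e (hk a₁ h₁) (hk a₂ h₂) (mt (h𝔟 _).mpr h)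
    refine ⟨r, ?_⟩
    rw [← Submodule.Quotient.mk_smul] at hr
    rw [h𝔟, sub_smul, Submodule.Quotient.mk_sub, hr, mul_smul, sub_self]
  have hclaim := fun a => dvd_mul_of_simple_socle hxI hIm hj hsI hms hsoc 𝔟
    ((h𝔟 _).mpr (quotSMulTop_mk_eq_zero_iff.mpr ⟨ξ, rfl⟩)) hker hsimple (a := a)
  -- `Q = (xR : I)`. The socle comparison says that `𝔪` annihilates `(I + xR) ∩ Q` modulo `x`, so `c
  -- ∈ 𝔪` splits into an annihilator `c₁` of `I` and an annihilator `c₂` of `Q`. The first lifts to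
  -- `J`; the second lies in `I + xR` by the double annihilator property.
  let Q : Ideal R :=
    { carrier := {r | ∀ i ∈ I, x ∣ r * i}
      add_mem' := fun ha hb i hi => by
        rw [add_mul]
        exact dvd_add (ha i hi) (hb i hi)
      zero_mem' := fun i _ => by simp
      smul_mem' := fun a b hb i hi => by
        rw [smul_eq_mul, mul_assoc]
        exact (hb i hi).mul_left a }
  have hxQ : x ∈ Q := fun i _ => dvd_mul_right x i
  have hxP : x ∈ I ⊔ Ideal.span {x} := Ideal.mem_sup_right (Ideal.mem_span_singleton_self x)
  obtain ⟨c₁, c₂, h12, h1, h2⟩ := hRinj.exists_add_of_inf hxP hxQ (c := c) (by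
    rintro p ⟨hpP, hpQ⟩
    obtain ⟨i, hi, y, hy, rfl⟩ := Submodule.mem_sup.mp hpP
    obtain ⟨t, rfl⟩ := Ideal.mem_span_singleton.mp hy
    have hiQ : i ∈ Q := by
      have := Q.sub_mem hpQ (Q.mul_mem_right t hxQ)
      rwa [add_sub_cancel_right] at this
    rw [add_mul, mul_assoc, mul_comm i]
    exact dvd_add (hclaim i hi hiQ c hc) (dvd_mul_right _ _))
  obtain ⟨d, hd0, hd1⟩ := exists_dvd_sub_of_forall_dvd hR hx hreg hxI (c := c₁) fun i hi => by
    rw [mul_comm]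
    exact h1 i (Ideal.mem_sup_left hi)
  have hc₂ : c₂ ∈ I ⊔ Ideal.span {x} := hRinj.mem_of_forall_annihilator hxs hms hxP fun t ht => by
    rw [mul_comm]
    refine h2 t fun i hi => ?_
    rw [mul_comm]
    exact ht i (Ideal.mem_sup_left hi)
  obtain ⟨i, hi, y, hy, rfl⟩ := Submodule.mem_sup.mp hc₂
  refine ⟨i, hi, d, hd0, ?_⟩
  have : c - (i + d) = c - (c₁ + (i + y)) + (c₁ - d) + y := by ring
  rw [this]
  exact dvd_add (dvd_add h12 hd1) (Ideal.mem_span_singleton.mp hy)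

lemma isSMulRegular_quotient_of_isCohenMacaulay [IsLocalRing R] [IsNoetherianRing R]
    (hd : ringKrullDim R = 1) (hCM : IsCohenMacaulayLocalRing (R ⧸ I))
    (hdI : ringKrullDim (R ⧸ I) = 1) {x : R} (hx : x ∈ IsLocalRing.maximalIdeal R)
    (hreg : IsSMulRegular R x) : IsSMulRegular (R ⧸ I) x := by
  obtain ⟨y, hy, hyreg⟩ := exists_isSMulRegular_of_localDepth_eq_one
    (hCM.depth_eq_dim.trans hdI)
  obtain ⟨y, rfl⟩ := Ideal.Quotient.mk_surjective y
  obtain ⟨j, hj⟩ := exists_maximalIdeal_pow_le_span hd hx hreg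
  have hym : y ∈ IsLocalRing.maximalIdeal R := by
    rw [IsLocalRing.mem_maximalIdeal, mem_nonunits_iff] at hy ⊢
    exact fun h => hy (h.map (Ideal.Quotient.mk I))
  refine isSMulRegular_of_pow_mem_span (y := y) (j := j) (fun a b hab => hyreg ?_)
    (hj (Ideal.pow_mem_pow hym j))
  change Ideal.Quotient.mk I y * a = Ideal.Quotient.mk I y * b
  have h : y • a = y • b := hab
  rwa [Algebra.smul_def, Algebra.smul_def] at h

theorem sup_eq_maximalIdeal_of_isAlmostGorenstein [IsLocalRing R] [IsNoetherianRing R]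
    (hd : ringKrullDim R = 1) (hR : HasInjectiveDimensionLE (ModuleCat.of R R) 1) (hI : I ≠ ⊥)
    (hIm : I ≤ IsLocalRing.maximalIdeal R) {x : R} (hx : x ∈ IsLocalRing.maximalIdeal R)
    (hreg : IsSMulRegular R x) (hxI : IsSMulRegular (R ⧸ I) x)
    (h : IsAlmostGorensteinLocalRing (TrivSqZeroExt R I)) :
    IsLocalRing.maximalIdeal R ≤ I ⊔ (⊥ : Ideal R).colon (I : Set R) := by
  have hdA : ringKrullDim (TrivSqZeroExt R I) = 1 := ringKrullDim_idealization.trans hd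
  have hA := h.toIsCohenMacaulayLocalRing
  obtain ⟨K, _, _, hK, φ, hφ, hC⟩ := h.exists_embedding
  have := hK.finite
  obtain ⟨y, hy, hyK⟩ := exists_isSMulRegular_of_localDepth_eq_one (hK.depth_eq_dim.trans hdA)
  have hinj := hasInjectiveDimensionLE_one hdA (idealization_mem_maximalIdeal (a := TrivSqZeroExt.inl x).mpr hx)
    (isSMulRegular_inl hreg) K hK.finite_injectiveDimension
  obtain ⟨d, hdd, ⟨e⟩⟩ := hK.type_one
  obtain rfl : d = 1 := by
    rw [hdA] at hdd
    exact_mod_cast hdd.symm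
  have hsmul : IsLocalRing.maximalIdeal (TrivSqZeroExt R I) •
      (⊤ : Submodule (TrivSqZeroExt R I) (K ⧸ LinearMap.range φ)) = ⊥ := by
    rcases hC with hC | ⟨_, d', hd', hC⟩
    · exact Subsingleton.elim _ _
    · obtain rfl : d' = 1 := by
        rw [hdA] at hd'
        exact_mod_cast hd'.symm
      exact maximalIdeal_smul_eq_bot_of_hasMultiplicity_zero _ hC
  have hξ : ∀ c ∈ IsLocalRing.maximalIdeal (TrivSqZeroExt R I), ∀ κ : K,
      ∃ a : TrivSqZeroExt R I, c • κ = a • φ 1 := by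
    intro c hc κ
    have h1 : c • (Submodule.Quotient.mk κ : K ⧸ LinearMap.range φ) ∈
        IsLocalRing.maximalIdeal (TrivSqZeroExt R I) •
          (⊤ : Submodule (TrivSqZeroExt R I) (K ⧸ LinearMap.range φ)) :=
      Submodule.smul_mem_smul hc trivial
    rw [hsmul, Submodule.mem_bot, ← Submodule.Quotient.mk_smul,
      Submodule.Quotient.mk_eq_zero] at h1
    obtain ⟨a, ha⟩ := h1
    exact ⟨a, by rw [← map_smul, smul_eq_mul, mul_one, ha]⟩
  -- Using `x ^ 2` places the error term in the square of the maximal ideal, as Nakayama requires.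
  have hx2 : x ^ 2 ∈ IsLocalRing.maximalIdeal R := Ideal.pow_mem_of_mem _ hx 2 two_pos
  obtain ⟨j, hj⟩ := exists_maximalIdeal_pow_le_span hdA
    (idealization_mem_maximalIdeal (a := TrivSqZeroExt.inl (x ^ 2)).mpr hx2)
    (isSMulRegular_inl (hreg.pow 2))
  refine Submodule.le_of_le_smul_of_le_jacobson_bot (I := IsLocalRing.maximalIdeal R)
    (IsNoetherian.noetherian _) (IsLocalRing.jacobson_eq_maximalIdeal _ bot_ne_top).ge ?_
  intro c hc
  obtain ⟨i, hi, d, hd0, y, hy⟩ := exists_dvd_sub_add_of_canonical hd hR hI hIm hx2 (hreg.pow 2)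
    (hxI.pow 2) hinj e (isSMulRegular_of_pow_mem_span hyK (hj (Ideal.pow_mem_pow hy j))) (φ 1) hξ hc
  rw [sub_eq_iff_eq_add'] at hy
  rw [hy]
  refine Submodule.add_mem_sup (Submodule.add_mem_sup hi ?_) ?_
  · rw [Submodule.mem_colon]
    exact fun i hi => (Submodule.mem_bot R).mpr (hd0 i hi)
  · rw [smul_eq_mul, ← pow_two]
    exact Ideal.mul_mem_right _ _ (Ideal.pow_mem_pow hx 2)

end Forward

/-! ### Coextension `Hom_R(R ⋉ I, -)` and its effect on injective dimension. -/

section Backward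

variable {R : Type u} [CommRing R] (I : Ideal R)

/-- The functor `Hom_R(R ⋉ I, -)` from `R`-modules to modules over the idealization. -/
noncomputable abbrev idealizationCoextend : ModuleCat.{u} R ⥤ ModuleCat.{u} (TrivSqZeroExt R I) :=
  ModuleCat.coextendScalars (TrivSqZeroExt.inlHom R I)

variable {I}

/-- Evaluation of an element of `Hom_R(R ⋉ I, M)`. -/
noncomputable def coextendEval {M : ModuleCat.{u} R} (g : (idealizationCoextend I).obj M)
    (a : TrivSqZeroExt R I) : M :=
  ModuleCat.CoextendScalars.equiv (TrivSqZeroExt.inlHom R I) M g a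

lemma coextendEval_add {M : ModuleCat.{u} R} (g : (idealizationCoextend I).obj M)
    (a b : TrivSqZeroExt R I) : coextendEval g (a + b) = coextendEval g a + coextendEval g b :=
  (ModuleCat.CoextendScalars.equiv (TrivSqZeroExt.inlHom R I) M g).map_add a b

lemma coextendEval_inl_mul {M : ModuleCat.{u} R} (g : (idealizationCoextend I).obj M)
    (r : R) (a : TrivSqZeroExt R I) :
    coextendEval g (TrivSqZeroExt.inl r * a) = r • coextendEval g a :=
  (ModuleCat.CoextendScalars.equiv (TrivSqZeroExt.inlHom R I) M g).map_smul r a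

lemma coextendEval_smul {M : ModuleCat.{u} R} (g : (idealizationCoextend I).obj M)
    (c a : TrivSqZeroExt R I) : coextendEval (c • g) a = coextendEval g (a * c) :=
  rfl

lemma coextend_ext {M : ModuleCat.{u} R} {g h : (idealizationCoextend I).obj M}
    (H : ∀ a : TrivSqZeroExt R I, coextendEval g a = coextendEval h a) : g = h :=
  ModuleCat.CoextendScalars.ext (LinearMap.ext H)

/-- The homomorphism `(a, i) ↦ a p + q i` on the idealization. -/
noncomputable def coextendMk {M : ModuleCat.{u} R} (p : M) (q : I →ₗ[R] M) :
    (idealizationCoextend I).obj M :=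
  have hadd : ∀ a b : TrivSqZeroExt R I, (a + b).fst • p + q (a + b).snd =
      (a.fst • p + q a.snd) + (b.fst • p + q b.snd) := fun a b => by
    rw [TrivSqZeroExt.fst_add, TrivSqZeroExt.snd_add, add_smul, map_add]
    abel
  have hsmul : ∀ (r : R) (a : TrivSqZeroExt R I),
      (TrivSqZeroExt.inl r * a).fst • p + q (TrivSqZeroExt.inl r * a).snd =
        r • (a.fst • p + q a.snd) := fun r a => by
    have h : (TrivSqZeroExt.inl r * a).snd = r • a.snd := Subtype.ext (by
      rw [idealization_snd_mul]
      simp)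
    rw [h, map_smul, idealization_fst_mul, TrivSqZeroExt.fst_inl, mul_smul, smul_add]
  (ModuleCat.CoextendScalars.equiv (TrivSqZeroExt.inlHom R I) M).symm
    { toFun := fun a : TrivSqZeroExt R I => a.fst • p + q a.snd
      map_add' := hadd
      map_smul' := hsmul }

lemma coextendEval_mk {M : ModuleCat.{u} R} (p : M) (q : I →ₗ[R] M) (a : TrivSqZeroExt R I) :
    coextendEval (coextendMk p q) a = a.fst • p + q a.snd := rfl

lemma exists_eq_coextendMk {M : ModuleCat.{u} R} (g : (idealizationCoextend I).obj M) :
    ∃ p q, g = coextendMk p q := by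
  refine ⟨coextendEval g 1,
    { toFun := fun i => coextendEval g (TrivSqZeroExt.inr i)
      map_add' := fun i j => by rw [TrivSqZeroExt.inr_add, coextendEval_add]
      map_smul' := fun r i => by
        rw [RingHom.id_apply, ← coextendEval_inl_mul, TrivSqZeroExt.inl_mul_inr] },
    coextend_ext fun a => ?_⟩
  rw [coextendEval_mk]
  conv_lhs => rw [← TrivSqZeroExt.inl_fst_add_inr_snd_eq a, coextendEval_add,
    ← mul_one (TrivSqZeroExt.inl a.fst), coextendEval_inl_mul]
  rfl

lemma coextendMk_injective {M : ModuleCat.{u} R} {p p' : M} {q q' : I →ₗ[R] M}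
    (h : coextendMk p q = coextendMk p' q') : p = p' ∧ q = q' := by
  have key : ∀ a : TrivSqZeroExt R I, a.fst • p + q a.snd = a.fst • p' + q' a.snd := fun a =>
    congr(coextendEval $h a)
  refine ⟨by simpa using key 1, LinearMap.ext fun i => by simpa using key (TrivSqZeroExt.inr i)⟩

lemma coextend_map_coextendMk {M N : ModuleCat.{u} R} (f : M ⟶ N) (p : M) (q : I →ₗ[R] M) :
    ((idealizationCoextend I).map f).hom (coextendMk p q) = coextendMk (f.hom p) (f.hom ∘ₗ q) :=
  coextend_ext fun a => by
    change f.hom (a.fst • p + q a.snd) = a.fst • f.hom p + f.hom (q a.snd)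
    rw [map_add, map_smul]

/-- Coextension is right adjoint to an exact functor, so it preserves injectives; it remains to see
that it keeps an injective resolution `0 → R → E → C → 0` exact. -/
lemma hasInjectiveDimensionLE_coextend (hR : HasInjectiveDimensionLE (ModuleCat.of R R) 1) :
    HasInjectiveDimensionLE ((idealizationCoextend I).obj (ModuleCat.of R R)) 1 := by
  let ⟨E, _, f, _⟩ := EnoughInjectives.presentation (ModuleCat.of R R)
  have injf : Function.Injective f.hom := (ModuleCat.mono_iff_injective f).mp ‹_›
  have hS := exactPairComplex_shortExact f.hom.exact_map_mkQ_range injf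
    (Submodule.mkQ_surjective _)
  have hE : Injective E := ‹Injective E›
  let C : ModuleCat.{u} R := ModuleCat.of R (E ⧸ LinearMap.range f.hom)
  have hC : Injective C := by
    rw [injective_iff_hasInjectiveDimensionLT_one]
    exact (hS.hasInjectiveDimensionLT_X₃_iff 0 hE).mpr hR
  let g : E ⟶ C := ModuleCat.ofHom (LinearMap.range f.hom).mkQ
  have hg : Function.Surjective g.hom := Submodule.mkQ_surjective _
  have hfg : Function.Exact f.hom g.hom := f.hom.exact_map_mkQ_range
  have hexact : Function.Exact ((idealizationCoextend I).map f).hom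
      ((idealizationCoextend I).map g).hom := by
    intro k
    obtain ⟨p, q, rfl⟩ := exists_eq_coextendMk k
    constructor
    · intro hk
      rw [coextend_map_coextendMk] at hk
      have h0 : coextendMk (g.hom p) (g.hom ∘ₗ q) = coextendMk (I := I) (M := C) 0 0 :=
        hk.trans (coextend_ext fun a => by
          rw [coextendEval_mk, smul_zero, LinearMap.zero_apply, add_zero]
          rfl)
      obtain ⟨hp, hq⟩ := coextendMk_injective h0
      obtain ⟨p', hp'⟩ := (hfg p).mp hp
      have hq' : ∀ i, q i ∈ LinearMap.range f.hom := fun i => (hfg (q i)).mp congr($hq i)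
      refine ⟨coextendMk p' ((LinearEquiv.ofInjective f.hom injf).symm.toLinearMap ∘ₗ
        q.codRestrict _ hq'), ?_⟩
      rw [coextend_map_coextendMk, hp']
      congr 1
      ext i
      exact congr(Subtype.val
        $((LinearEquiv.ofInjective f.hom injf).apply_symm_apply ⟨q i, hq' i⟩))
    · rintro ⟨k, hk⟩
      obtain ⟨p', q', rfl⟩ := exists_eq_coextendMk k
      rw [← hk]
      refine coextend_ext fun a => ?_
      change g.hom (f.hom _) = 0
      exact hfg.apply_apply_eq_zero _
  have hinj : Function.Injective ((idealizationCoextend I).map f).hom := by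
    intro k l hkl
    refine coextend_ext fun a => injf ?_
    exact congr(coextendEval $hkl a)
  have hsurj : Function.Surjective ((idealizationCoextend I).map g).hom := by
    intro k
    obtain ⟨p, q, rfl⟩ := exists_eq_coextendMk k
    have : Module.Injective R C := Module.injective_module_of_injective_object R C
    -- A map `I → C` extends to `R` because `C` is injective, and a map from the free module `R`
    -- lifts to `E`.
    obtain ⟨q', hq'⟩ := Module.Injective.out I.subtype I.injective_subtype q
    obtain ⟨p₀, hp₀⟩ := hg p
    obtain ⟨e, he⟩ := hg (q' 1)
    refine ⟨coextendMk p₀ (LinearMap.toSpanSingleton R E e ∘ₗ I.subtype), ?_⟩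
    rw [coextend_map_coextendMk, hp₀]
    congr 1
    ext i
    change g.hom ((i : R) • e) = q i
    rw [map_smul, he, ← map_smul, smul_eq_mul, mul_one, ← hq']
    rfl
  have hS' := exactPairComplex_shortExact hexact hinj hsurj
  have hE' : Injective ((idealizationCoextend I).obj E) :=
    Injective.injective_of_adjoint (ModuleCat.restrictCoextendScalarsAdj _) E
  have hC' : Injective ((idealizationCoextend I).obj C) :=
    Injective.injective_of_adjoint (ModuleCat.restrictCoextendScalarsAdj _) C
  refine hS'.hasInjectiveDimensionLT_X₁ (n := 1) ?_ ?_
  · exact inferInstanceAs (HasInjectiveDimensionLT ((idealizationCoextend I).obj C) 1)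
  · exact inferInstanceAs (HasInjectiveDimensionLT ((idealizationCoextend I).obj E) (1 + 1))

end Backward

/-! ### The canonical module `R ⊕ R/J` and the explicit embedding. -/

section CanonicalModule

variable {R : Type u} [CommRing R] {I : Ideal R}

/-- The homomorphism `(a, i) ↦ a p + r i` as an element of `Hom_R(R ⋉ I, R)`. -/
noncomputable def dualMk (I : Ideal R) (p r : R) :
    (idealizationCoextend I).obj (ModuleCat.of R R) :=
  coextendMk (M := ModuleCat.of R R) p (LinearMap.mulLeft R r ∘ₗ I.subtype)

lemma coextendEval_dualMk (p r : R) (a : TrivSqZeroExt R I) :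
    coextendEval (dualMk I p r) a = a.fst * p + r * (a.snd : R) := rfl

lemma smul_dualMk (c : TrivSqZeroExt R I) (p r : R) :
    c • dualMk I p r = dualMk I (c.fst * p + r * c.snd) (c.fst * r) :=
  coextend_ext fun a => by
    rw [coextendEval_smul, coextendEval_dualMk, coextendEval_dualMk, idealization_fst_mul,
      idealization_snd_mul]
    change (_ : R) = _
    ring

lemma dualMk_eq_iff {p r p' r' : R} :
    dualMk I p r = dualMk I p' r' ↔ p = p' ∧ ∀ i ∈ I, r * i = r' * i := by
  constructor
  · intro h
    obtain ⟨h1, h2⟩ := coextendMk_injective h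
    exact ⟨h1, fun i hi => congr($h2 ⟨i, hi⟩)⟩
  · rintro ⟨rfl, h⟩
    refine coextend_ext fun a => ?_
    rw [coextendEval_dualMk, coextendEval_dualMk, h _ a.snd.2]

lemma dualMk_add (p r p' r' : R) :
    dualMk I p r + dualMk I p' r' = dualMk I (p + p') (r + r') :=
  coextend_ext fun a => by
    change coextendEval (dualMk I p r) a + coextendEval (dualMk I p' r') a = _
    rw [coextendEval_dualMk, coextendEval_dualMk, coextendEval_dualMk]
    change (_ : R) = _
    ring

lemma exists_eq_dualMk [IsLocalRing R] [IsNoetherianRing R]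
    (hR : HasInjectiveDimensionLE (ModuleCat.of R R) 1) {x : R}
    (hx : x ∈ IsLocalRing.maximalIdeal R) (hxI : IsSMulRegular (R ⧸ I) x)
    (g : (idealizationCoextend I).obj (ModuleCat.of R R)) : ∃ p r, g = dualMk I p r := by
  obtain ⟨p, q, rfl⟩ := exists_eq_coextendMk g
  obtain ⟨r, hr⟩ := exists_eq_mul_of_hom hR hx hxI q
  exact ⟨p, r, congrArg _ (LinearMap.ext hr)⟩

lemma isSMulRegular_dual {x : R} (hreg : IsSMulRegular R x) :
    IsSMulRegular ((idealizationCoextend I).obj (ModuleCat.of R R))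
      (TrivSqZeroExt.inl x : TrivSqZeroExt R I) := by
  intro g h hgh
  refine coextend_ext fun a => hreg ?_
  have h1 : coextendEval g (a * TrivSqZeroExt.inl x) = coextendEval h (a * TrivSqZeroExt.inl x) :=
    congr(coextendEval $hgh a)
  rwa [mul_comm, coextendEval_inl_mul, coextendEval_inl_mul] at h1

lemma isCohenMacaulay_idealization [IsLocalRing R] [IsNoetherianRing R] (hd : ringKrullDim R = 1)
    {x : R} (hx : x ∈ IsLocalRing.maximalIdeal R) (hreg : IsSMulRegular R x) :
    IsCohenMacaulayLocalRing (TrivSqZeroExt R I) where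
  depth_eq_dim := by
    have hdA : ringKrullDim (TrivSqZeroExt R I) = 1 := ringKrullDim_idealization.trans hd
    rw [hdA, localDepth_eq_one hdA
      (idealization_mem_maximalIdeal (a := TrivSqZeroExt.inl x).mpr hx) (isSMulRegular_inl hreg)]
    rfl

/-- `Hom_R(R ⋉ I, R)` is a canonical module of the idealization. -/
theorem isCanonicalModule_dual [IsLocalRing R] [IsNoetherianRing R] (hd : ringKrullDim R = 1)
    (hR : HasInjectiveDimensionLE (ModuleCat.of R R) 1) (hI : I ≠ ⊥)
    {x : R} (hx : x ∈ IsLocalRing.maximalIdeal R)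
    (hreg : IsSMulRegular R x) (hxI : IsSMulRegular (R ⧸ I) x)
    [IsCohenMacaulayLocalRing (TrivSqZeroExt R I)] :
    IsCanonicalModule (TrivSqZeroExt R I) ((idealizationCoextend I).obj (ModuleCat.of R R)) := by
  have hdA : ringKrullDim (TrivSqZeroExt R I) = 1 := ringKrullDim_idealization.trans hd
  have hX : (TrivSqZeroExt.inl x : TrivSqZeroExt R I) ∈ IsLocalRing.maximalIdeal _ :=
    idealization_mem_maximalIdeal.mpr hx
  have hfin : Module.Finite (TrivSqZeroExt R I)
      ((idealizationCoextend I).obj (ModuleCat.of R R)) := by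
    refine ⟨Submodule.fg_def.mpr ⟨{dualMk I 1 0, dualMk I 0 1}, Set.toFinite _, ?_⟩⟩
    rw [eq_top_iff]
    intro g _
    obtain ⟨p, r, rfl⟩ := exists_eq_dualMk hR hx hxI g
    rw [Submodule.mem_span_pair]
    exact ⟨TrivSqZeroExt.inl p, TrivSqZeroExt.inl r, by
      rw [smul_dualMk, smul_dualMk, dualMk_add]
      simp⟩
  have hnt : Nontrivial ((idealizationCoextend I).obj (ModuleCat.of R R)) :=
    ⟨dualMk I 1 0, dualMk I 0 0, fun h => one_ne_zero (dualMk_eq_iff.mp h).1⟩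
  refine ⟨hfin, ?_, ⟨1, hasInjectiveDimensionLE_coextend hR⟩, 1, hdA, ?_⟩
  · rw [hdA, localDepth_eq_one hdA hX (isSMulRegular_dual hreg)]
    rfl
  obtain ⟨j, hj⟩ := exists_maximalIdeal_pow_le_span hd hx hreg
  obtain ⟨s, hsI, hxs, hms⟩ := exists_socle_mem hI hx hxI hj
  have hRinj := isInjectiveModulo_quotSMulTop hreg hR
  have hsoc : ∀ t, (∀ c ∈ IsLocalRing.maximalIdeal R, x ∣ c * t) → ∃ r, x ∣ t - r * s :=
    fun t ht => hRinj.exists_dvd_sub fun c hcs => by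
      by_cases hm : c ∈ IsLocalRing.maximalIdeal R
      · exact ht c hm
      · have hu : IsUnit c := by simpa using hm
        exact absurd ((IsUnit.dvd_mul_left hu).mp hcs) hxs
  have hzero : ∀ p r, (Submodule.Quotient.mk (dualMk I p r) :
      QuotSMulTop (TrivSqZeroExt.inl x : TrivSqZeroExt R I)
        ((idealizationCoextend I).obj (ModuleCat.of R R))) = 0 ↔
        x ∣ p ∧ ∃ r', ∀ i ∈ I, r * i = x * r' * i := fun p r => by
    rw [quotSMulTop_mk_eq_zero_iff]
    constructor
    · rintro ⟨g, hg⟩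
      obtain ⟨p', r', rfl⟩ := exists_eq_dualMk hR hx hxI g
      rw [smul_dualMk, dualMk_eq_iff] at hg
      simp only [TrivSqZeroExt.fst_inl, TrivSqZeroExt.snd_inl, ZeroMemClass.coe_zero, mul_zero,
        add_zero] at hg
      exact ⟨⟨p', hg.1.symm⟩, r', fun i hi => (hg.2 i hi).symm⟩
    · rintro ⟨⟨p', rfl⟩, r', hr'⟩
      refine ⟨dualMk I p' r', ?_⟩
      rw [smul_dualMk, dualMk_eq_iff]
      simpa using fun i hi => (hr' i hi).symm
  refine nonempty_ext_equiv_of_socle hX (isSMulRegular_dual hreg)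
    (v := Submodule.Quotient.mk (dualMk I s 0)) (fun c hc => ?_) (fun h => ?_) fun w hw => ?_
  · rw [← Submodule.Quotient.mk_smul, smul_dualMk, hzero]
    rw [idealization_mem_maximalIdeal] at hc
    exact ⟨by simpa using hms _ hc, 0, by simp⟩
  · exact hxs ((hzero _ _).mp h).1
  · obtain ⟨g, rfl⟩ := Submodule.Quotient.mk_surjective _ w
    obtain ⟨p, r, rfl⟩ := exists_eq_dualMk hR hx hxI g
    have hw' := fun c hc => by
      have := hw c hc
      rwa [← Submodule.Quotient.mk_smul, smul_dualMk, hzero] at this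
    -- For `(p, r)` in the socle modulo `x`, the elements `(0, i)` force `r ∈ J + xR`, so `r`
    -- contributes nothing. The elements `(c, 0)` put `p` in the socle of `R/xR`, generated by `s`.
    obtain ⟨d, hd0, y, hy⟩ := exists_dvd_sub_of_forall_dvd hR hx hreg hxI (c := r) fun i hi => by
      have := (hw' (TrivSqZeroExt.inr ⟨i, hi⟩) (idealization_mem_maximalIdeal.mpr (by simp))).1
      simpa using this
    obtain ⟨q, hq⟩ := hsoc p fun c hc => by
      have := (hw' (TrivSqZeroExt.inl c) (idealization_mem_maximalIdeal.mpr hc)).1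
      simpa using this
    refine ⟨TrivSqZeroExt.inl q, ?_⟩
    rw [← Submodule.Quotient.mk_smul, ← sub_eq_zero, ← Submodule.Quotient.mk_sub, smul_dualMk]
    have h1 : dualMk I p r - dualMk I (q * s) 0 = dualMk I (p - q * s) r := by
      rw [sub_eq_iff_eq_add, dualMk_add, sub_add_cancel, add_zero]
    have h2 : dualMk I ((TrivSqZeroExt.inl q : TrivSqZeroExt R I).fst * s +
        0 * ((TrivSqZeroExt.inl q : TrivSqZeroExt R I).snd : R))
        ((TrivSqZeroExt.inl q : TrivSqZeroExt R I).fst * 0) = dualMk I (q * s) 0 := by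
      simp
    rw [h2, h1, hzero]
    exact ⟨hq, y, fun i hi => by linear_combination i * hy + hd0 i hi⟩

theorem isAlmostGorenstein_of_sup_eq [IsLocalRing R] [IsNoetherianRing R]
    (hd : ringKrullDim R = 1) (hR : HasInjectiveDimensionLE (ModuleCat.of R R) 1) (hI : I ≠ ⊥)
    (hIm : I ≤ IsLocalRing.maximalIdeal R)
    {x : R} (hx : x ∈ IsLocalRing.maximalIdeal R)
    (hreg : IsSMulRegular R x) (hxI : IsSMulRegular (R ⧸ I) x) {J : Ideal R}
    (hJ : ∀ d ∈ J, ∀ i ∈ I, d * i = 0) (hJ' : ∀ d, (∀ i ∈ I, d * i = 0) → d ∈ J)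
    (hsup : IsLocalRing.maximalIdeal R ≤ I ⊔ J) (hinf : I ⊓ J = ⊥) :
    IsAlmostGorensteinLocalRing (TrivSqZeroExt R I) := by
  have hdA : ringKrullDim (TrivSqZeroExt R I) = 1 := ringKrullDim_idealization.trans hd
  have hCM := isCohenMacaulay_idealization (I := I) hd hx hreg
  have hK := isCanonicalModule_dual hd hR hI hx hreg hxI
  refine ⟨hCM, _, _, _, hK, LinearMap.toSpanSingleton _ _ (dualMk I 1 1), ?_, ?_⟩
  · rw [injective_iff_map_eq_zero]
    intro a ha
    rw [LinearMap.toSpanSingleton_apply, smul_dualMk] at ha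
    have h0 : dualMk I (a.fst * 1 + 1 * a.snd) (a.fst * 1) = dualMk I 0 0 :=
      ha.trans (coextend_ext fun b => by
        rw [coextendEval_dualMk, mul_zero, zero_mul, add_zero]
        rfl)
    obtain ⟨h1, h2⟩ := dualMk_eq_iff.mp h0
    -- Since `a • (1, 1) = (a.fst + a.snd, a.fst)`, an element of the kernel has `a.fst` in `J` and
    -- equal to `-a.snd`, which lies in `I`.
    have hmem : a.fst ∈ I ⊓ J := by
      refine ⟨?_, hJ' _ fun i hi => by simpa using h2 i hi⟩
      have : a.fst = -(a.snd : R) := by linear_combination h1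
      exact this ▸ I.neg_mem a.snd.2
    rw [hinf, Submodule.mem_bot] at hmem
    refine idealization_ext hmem ?_
    rw [TrivSqZeroExt.snd_zero, ZeroMemClass.coe_zero]
    linear_combination h1 - hmem
  · set φ := LinearMap.toSpanSingleton (TrivSqZeroExt R I) _ (dualMk I 1 1)
    have hfin := hK.finite
    have hsmul : IsLocalRing.maximalIdeal (TrivSqZeroExt R I) • (⊤ : Submodule (TrivSqZeroExt R I)
        ((idealizationCoextend I).obj (ModuleCat.of R R) ⧸ LinearMap.range φ)) = ⊥ := by
      rw [eq_bot_iff, Submodule.smul_le]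
      rintro c hc w -
      obtain ⟨g, rfl⟩ := Submodule.Quotient.mk_surjective _ w
      obtain ⟨p, r, rfl⟩ := exists_eq_dualMk hR hx hxI g
      rw [Submodule.mem_bot, ← Submodule.Quotient.mk_smul, Submodule.Quotient.mk_eq_zero,
        smul_dualMk]
      rw [idealization_mem_maximalIdeal] at hc
      obtain ⟨i, hi, d, hdJ, hP⟩ := Submodule.mem_sup.mp (hsup (Ideal.add_mem _
        (Ideal.mul_mem_right p _ hc) (Ideal.mul_mem_left _ r (hIm c.snd.2))))
      obtain ⟨i', hi', d', hdJ', hQ⟩ := Submodule.mem_sup.mp (hsup (Ideal.mul_mem_right r _ hc))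
      -- The target is `(i + d, i' + d')` with second entry modulo `J`, and `(u, w) • (1, 1) = (u +
      -- w, u)`. Taking `u = i' + d` changes the second entry only by `d - d' ∈ J` and leaves `w = i
      -- - i'` in `I`.
      refine ⟨idealizationMk (i' + d) (i - i') (I.sub_mem hi hi'), ?_⟩
      rw [LinearMap.toSpanSingleton_apply, smul_dualMk, dualMk_eq_iff, idealizationMk_fst,
        idealizationMk_snd]
      refine ⟨by linear_combination hP, fun k hk => ?_⟩
      linear_combination k * hQ + hJ d hdJ k hk - hJ d' hdJ' k hk
    cases subsingleton_or_nontrivial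
      ((idealizationCoextend I).obj (ModuleCat.of R R) ⧸ LinearMap.range φ) with
    | inl h => exact Or.inl h
    | inr h =>
      exact Or.inr ⟨h, 1, hdA, hasMultiplicity_zero_of_maximalIdeal_smul_eq_bot _ hsmul⟩

end CanonicalModule

/-! ### The equivalence. -/

theorem lemma2p3 {R : Type u} [CommRing R] [IsGorensteinLocalRing R]
    (hd : ringKrullDim R = 1)
    (I : Ideal R) (hI : I ≠ ⊥)
    (hCM : IsCohenMacaulayLocalRing (R ⧸ I)) (hdI : ringKrullDim (R ⧸ I) = 1)
    (J : Ideal R) (hJ : J = (⊥ : Ideal R).colon (I : Set R)) :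
    (IsAlmostGorensteinLocalRing (TrivSqZeroExt R I) ↔ I ⊔ J = IsLocalRing.maximalIdeal R) ∧
      (I ⊔ J = IsLocalRing.maximalIdeal R → I ⊓ J = ⊥) := by
  obtain ⟨x, hx, hreg⟩ := exists_isSMulRegular_self hd
    IsGorensteinLocalRing.finite_injectiveDimension
  have hR := hasInjectiveDimensionLE_one hd hx hreg R
    IsGorensteinLocalRing.finite_injectiveDimension
  have hxI := isSMulRegular_quotient_of_isCohenMacaulay hd hCM hdI hx hreg
  have hIm : I ≤ IsLocalRing.maximalIdeal R :=
    IsLocalRing.le_maximalIdeal (Ideal.Quotient.nontrivial_iff.mp inferInstance)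
  have hmem : ∀ d, d ∈ J ↔ ∀ i ∈ I, d * i = 0 := fun d => by
    rw [hJ, Submodule.mem_colon]
    rfl
  have hJm : J ≤ IsLocalRing.maximalIdeal R := IsLocalRing.le_maximalIdeal fun h => hI <| by
    rw [eq_bot_iff]
    intro i hi
    have h1 := (hmem 1).mp (h ▸ trivial) i hi
    rwa [one_mul] at h1
  have hinf : I ⊔ J = IsLocalRing.maximalIdeal R → I ⊓ J = ⊥ := by
    intro h
    rw [eq_bot_iff]
    rintro z ⟨hzI, hzJ⟩
    -- Writing `x = i + d` gives `x z = i z + d z = 0`, because `z` lies in both `J` and `I`.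
    obtain ⟨i, hi, d, hdJ, hid⟩ := Submodule.mem_sup.mp (h.symm ▸ hx : x ∈ I ⊔ J)
    refine hreg (?_ : x * z = x * 0)
    linear_combination -z * hid + (hmem d).mp hdJ z hzI + (hmem z).mp hzJ i hi
  refine ⟨⟨fun h => le_antisymm (sup_le hIm hJm) ?_, fun h => ?_⟩, hinf⟩
  · rw [hJ]
    exact sup_eq_maximalIdeal_of_isAlmostGorenstein hd hR hI hIm hx hreg hxI h
  · exact isAlmostGorenstein_of_sup_eq hd hR hI hIm hx hreg hxI (fun d => (hmem d).mp)
      (fun d => (hmem d).mpr) h.ge (hinf h)
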